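/- Let $C$ be an infinite cyclic group, let $I$ be the augmentation ideal of $\mathbb Z[C]$, and let $M$ be a tame $\mathbb Z[C]$-module, that is, a finitely generated $\mathbb Z[C]$-module such that the group $M\rtimes C$ is finitely presented. Let $t$ be a generator of $C$, let $\mu_M\in\mathbb Q[x]$ be the minimal polynomial of the $\mathbb Q$-linear endomorphism $t\otimes\mathbb Q$ of $M\otimes\mathbb Q$, and suppose that $\mu_M=(x-1)^m f$ for some $m\ge 0$ and some $f\in\mathbb Z[x]$ with $f(1)\in\{-1,1\}$. Then: (1) $M$ is prenilpotent: $MI^n=MI^{n+1}$ for all sufficiently large $n$. (2) $H\mathbb Z\text{-}\mathsf{length}(M\rtimes C)<\omega$. Here an $H\mathbb Z$-map is a group homomorphism that induces an isomorphism on $H_1(-,\mathbb Z)$ and an epimorphism on $H_2(-,\mathbb Z)$; a group $\Gamma$ is $H\mathbb Z$-local if every $H\mathbb Z$-map $G\to H$ induces a bijection $\mathrm{Hom}(H,\Gamma)\to\mathrm{Hom}(G,\Gamma)$; an $H\mathbb Z$-localization of $G$ is an $H\mathbb Z$-map $\eta:G\to EG$ with $EG$ an $H\mathbb Z$-local group;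 and $H\mathbb Z\text{-}\mathsf{length}(G)$ is the least ordinal $\tau\ge1$ with $\gamma_\tau(EG)=1$, where $\gamma_1(EG)=EG$, $\gamma_{\tau+1}(EG)=[\gamma_\tau(EG),EG]$ and $\gamma_\alpha(EG)=\bigcap_{\tau<\alpha}\gamma_\tau(EG)$ for limit ordinals $\alpha$. Statement (2) includes that an $H\mathbb Z$-localization of $M\rtimes C$ exists. -/

import Mathlib

open scoped TensorProduct Polynomial

universe u v

/-! ### Modules over the integral group ring of an infinite cyclic group -/

/-- The augmentation ideal `I` of the group ring `ℤ[C]`. -/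
noncomputable def augmentationIdeal (C : Type u) [CommGroup C] : Ideal (MonoidAlgebra ℤ C) :=
  RingHom.ker (MonoidAlgebra.lift ℤ ℤ C (1 : C →* ℤ))

/-- A `ℤ[C]`-module `M` is prenilpotent if `M Iⁿ = M Iⁿ⁺¹` for all sufficiently large `n`. -/
def IsPrenilpotent (C : Type v) [CommGroup C] (M : Type u) [AddCommGroup M]
    [Module (MonoidAlgebra ℤ C) M] : Prop :=
  ∃ N : ℕ, ∀ n ≥ N,
    augmentationIdeal C ^ n • (⊤ : Submodule (MonoidAlgebra ℤ C) M) =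
      augmentationIdeal C ^ (n + 1) • (⊤ : Submodule (MonoidAlgebra ℤ C) M)

/-- The action of `C` on (the multiplicative version of) `M` by group automorphisms. -/
noncomputable def moduleAction (C : Type v) [CommGroup C] (M : Type u) [AddCommGroup M]
    [Module (MonoidAlgebra ℤ C) M] : C →* MulAut (Multiplicative M) :=
  (MulAutMultiplicative M).symm.toMonoidHom.comp
    ((DistribMulAction.toAddAut (MonoidAlgebra ℤ C)ˣ M).comp (MonoidAlgebra.of ℤ C).toHomUnits)

theorem moduleAction_apply (C : Type v) [CommGroup C] (M : Type u) [AddCommGroup M]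
    [Module (MonoidAlgebra ℤ C) M] (c : C) (x : M) :
    moduleAction C M c (Multiplicative.ofAdd x) =
      Multiplicative.ofAdd (MonoidAlgebra.of ℤ C c • x) := rfl

/-- The semidirect product `M ⋊ C`. -/
abbrev ModuleSemidirect (C : Type v) [CommGroup C] (M : Type u) [AddCommGroup M]
    [Module (MonoidAlgebra ℤ C) M] : Type (max u v) :=
  Multiplicative M ⋊[moduleAction C M] C

/-- A finitely generated `ℤ[C]`-module `M` is tame if `M ⋊ C` is a finitely presented group. -/
structure IsTame (C : Type v) [CommGroup C] (M : Type u) [AddCommGroup M]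
    [Module (MonoidAlgebra ℤ C) M] : Prop where
  finite : Module.Finite (MonoidAlgebra ℤ C) M
  finitelyPresented : Group.IsFinitelyPresented (ModuleSemidirect C M)

/-- The `ℚ`-linear endomorphism of `ℚ ⊗ M` induced by the action of `t ∈ C` on `M`. -/
noncomputable def rationalAction {C : Type v} [CommGroup C] (M : Type u) [AddCommGroup M]
    [Module (MonoidAlgebra ℤ C) M] (t : C) : Module.End ℚ (ℚ ⊗[ℤ] M) :=
  LinearMap.baseChange ℚ
    (DistribSMul.toAddMonoidHom M (MonoidAlgebra.of ℤ C t)).toIntLinearMap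

theorem rationalAction_tmul {C : Type v} [CommGroup C] (M : Type u) [AddCommGroup M]
    [Module (MonoidAlgebra ℤ C) M] (t : C) (q : ℚ) (x : M) :
    rationalAction M t (q ⊗ₜ[ℤ] x) = q ⊗ₜ[ℤ] (MonoidAlgebra.of ℤ C t • x) := rfl

/-! ### `Hℤ`-localization and `Hℤ`-length of groups -/

/-- The map induced by a group homomorphism on integral homology `Hₙ(-, ℤ)`
(with trivial coefficients, lifted to the universe of the groups). -/
noncomputable def integralHomologyMap {G H : Type u} [Group G] [Group H] (f : G →* H) (n : ℕ) :
    groupHomology (Rep.trivial (ULift.{u} ℤ) G (ULift.{u} ℤ)) n ⟶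
      groupHomology (Rep.trivial (ULift.{u} ℤ) H (ULift.{u} ℤ)) n :=
  groupHomology.map f
    (CategoryTheory.CategoryStruct.id (Rep.trivial (ULift.{u} ℤ) G (ULift.{u} ℤ))) n

/-- An `Hℤ`-map is a homomorphism inducing an isomorphism on `H₁` and an epimorphism on `H₂`. -/
structure IsHZMap {G H : Type u} [Group G] [Group H] (f : G →* H) : Prop where
  bijective_one : Function.Bijective (integralHomologyMap f 1)
  surjective_two : Function.Surjective (integralHomologyMap f 2)

/-- A group `Γ` is `Hℤ`-local if every `Hℤ`-map `G → H` induces a bijection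
`Hom(H, Γ) ≃ Hom(G, Γ)`. -/
def IsHZLocal (Γ : Type u) [Group Γ] : Prop :=
  ∀ (G H : Type u) [Group G] [Group H] (f : G →* H), IsHZMap f →
    Function.Bijective (fun g : H →* Γ => g.comp f)

/-- `η : G → E` is an `Hℤ`-localization of `G`: `η` is an `Hℤ`-map and `E` is `Hℤ`-local. -/
structure IsHZLocalization {G E : Type u} [Group G] [Group E] (η : G →* E) : Prop where
  isHZMap : IsHZMap η
  isHZLocal : IsHZLocal E

/-- The transfinite lower central series, indexed so that `γ₁(G) = G`:
`γ_{τ+1}(G) = [γ_τ(G), G]` for `τ ≥ 1` and `γ_α(G) = ⋂_{τ < α} γ_τ(G)` for limit `α`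
(the value at `0` is also `G`). -/
noncomputable def transfiniteLowerCentralSeries (G : Type u) [Group G] (τ : Ordinal.{u}) :
    Subgroup G :=
  open Classical in
  Ordinal.limitRecOn τ ⊤ (fun σ γ => if σ = 0 then ⊤ else ⁅γ, (⊤ : Subgroup G)⁆)
    (fun _ _ γ => ⨅ σ, ⨅ h, γ σ h)

/-- `τ` is the `Hℤ`-length of `G`: an `Hℤ`-localization `G → EG` exists, and for every such
localization, `τ` is the least (nonzero) ordinal with `γ_τ(EG) = 1`. -/
def HasHZLength (G : Type u) [Group G] (τ : Ordinal.{u}) : Prop :=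
  (∃ (E : Type u) (_ : Group E) (η : G →* E), IsHZLocalization η) ∧
    ∀ (E : Type u) [Group E] (η : G →* E), IsHZLocalization η →
      IsLeast {σ : Ordinal.{u} | 1 ≤ σ ∧ transfiniteLowerCentralSeries E σ = ⊥} τ

/-!
Let `G = M ⋊ C` and `s = t - 1`, so that `I = (s)`. The proof has three parts.

*Stabilization.* The aim is `sⁿ M = sⁿ⁺¹ M` for some `n`. The hypothesis on the minimal polynomial
gives an integer `e ≥ 1` with `e (t - 1)ᵐ f(t) M = 0`, and `f(t) ≡ ±1` modulo `s`; hence it is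
enough that `sⁿ M ⊆ sⁿ⁺¹ M + e M` for some `n`, and by induction on the number of prime factors it
is enough to treat a prime `ℓ` in place of `e`. For a prime this holds as soon as `M / ℓ M` is a
torsion module over `𝔽_ℓ[t]`, because the factors of an annihilating polynomial prime to `t - 1`
are units modulo `(s, ℓ)`.

*Tameness.* Suppose that `x ∈ M / ℓ M` is not torsion (`IsTame.exists_polynomial_smul_eq`). There
are additive maps `φ` and `θ` from `M` to the field `K = 𝔽_ℓ(X)`, both nonzero at `x`, under which
`t` acts as `X` and as `X⁻¹`. The product `β(u, v) = φ(u) θ(v)` is `C`-invariant and defines a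
central extension of `G` by `K`. Lifting a finite presentation of `G` to this extension
shows that all commutators `β(u, v) - β(v, u)` of lifts of elements of `M` lie in a finitely
generated subgroup of `K`, which is finite. But for `u = tⁿ x` and `v = x` infinitely many values
occur.

*Localization.* The subgroup `N = Iⁿ M` of `G` satisfies `N = [N, G]`, and `G / N` is nilpotent.
By a computation with bar chains, the projection `G → G / N` is an `Hℤ`-map
(`isHZMap_of_surjective_of_ker_le`): the obstruction to surjectivity on `H₂` lies in `N / [N, G]`.
Nilpotent groups are `Hℤ`-local (`isHZLocal_of_isNilpotent`): one lifts homomorphisms through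
central extensions, where an `Hℤ`-map allows factor sets to be trivialized in a unique way
compatible with a given trivialization on the source. So `G / N` is the localization, and
the `Hℤ`-length is its nilpotency class plus one.
-/

/-! ### Integral homology in degrees one and two via bar chains -/

/-- The coefficient ring of integral homology: `ℤ`, lifted to the universe of the groups. -/
abbrev IntCoeff : Type u := ULift.{u} ℤ

/-- The differential `[g, h] ↦ [h] - [gh] + [g]` from bar 2-chains to bar 1-chains. -/
noncomputable def barBoundaryTwo (G : Type u) [Group G] :
    (G × G →₀ IntCoeff.{u}) →ₗ[IntCoeff.{u}] (G →₀ IntCoeff.{u}) :=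
  Finsupp.linearCombination IntCoeff.{u} fun p =>
    Finsupp.single p.2 1 - Finsupp.single (p.1 * p.2) 1 + Finsupp.single p.1 1

/-- The differential `[g, h, k] ↦ [h, k] - [gh, k] + [g, hk] - [g, h]` from bar 3-chains to
bar 2-chains. -/
noncomputable def barBoundaryThree (G : Type u) [Group G] :
    (G × G × G →₀ IntCoeff.{u}) →ₗ[IntCoeff.{u}] (G × G →₀ IntCoeff.{u}) :=
  Finsupp.linearCombination IntCoeff.{u} fun p =>
    Finsupp.single (p.2.1, p.2.2) 1 - Finsupp.single (p.1 * p.2.1, p.2.2) 1 +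
      Finsupp.single (p.1, p.2.1 * p.2.2) 1 - Finsupp.single (p.1, p.2.1) 1

section
variable {G H : Type u} [Group G] [Group H]

@[simp] theorem barBoundaryTwo_single (g h : G) (a : IntCoeff.{u}) :
    barBoundaryTwo G (Finsupp.single (g, h) a) =
      Finsupp.single h a - Finsupp.single (g * h) a + Finsupp.single g a := by
  simp [barBoundaryTwo, smul_add, smul_sub]

@[simp] theorem barBoundaryThree_single (g h k : G) (a : IntCoeff.{u}) :
    barBoundaryThree G (Finsupp.single (g, h, k) a) =
      Finsupp.single (h, k) a - Finsupp.single (g * h, k) a +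
      Finsupp.single (g, h * k) a - Finsupp.single (g, h) a := by
  simp [barBoundaryThree, smul_add, smul_sub]

/-- The map on bar 1-chains induced by a homomorphism. -/
noncomputable abbrev barMapOne (f : G →* H) :
    (G →₀ IntCoeff.{u}) →ₗ[IntCoeff.{u}] (H →₀ IntCoeff.{u}) :=
  Finsupp.lmapDomain _ _ f

/-- The map on bar 2-chains induced by a homomorphism. -/
noncomputable abbrev barMapTwo (f : G →* H) :
    (G × G →₀ IntCoeff.{u}) →ₗ[IntCoeff.{u}] (H × H →₀ IntCoeff.{u}) :=
  Finsupp.lmapDomain _ _ (Prod.map f f)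

theorem barBoundaryTwo_barMapTwo (f : G →* H) (x : G × G →₀ IntCoeff.{u}) :
    barBoundaryTwo H (barMapTwo f x) = barMapOne f (barBoundaryTwo G x) := by
  induction x using Finsupp.induction_linear with
  | zero => simp
  | add x y hx hy => rw [map_add, map_add, hx, hy, map_add, map_add]
  | single p a =>
    obtain ⟨g, h⟩ := p
    simp [Finsupp.mapDomain_single, map_sub, map_add]

variable (G) in
/-- The trivial representation with integral coefficients. -/
noncomputable abbrev intRep : Rep (ULift.{u} ℤ) G :=
  Rep.trivial (ULift.{u} ℤ) G (ULift.{u} ℤ)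

open groupHomology CategoryTheory

theorem d₂₁_intRep_hom : (d₂₁ (intRep G)).hom = barBoundaryTwo G := by
  refine Finsupp.lhom_ext fun ⟨g, h⟩ a => ?_
  exact (d₂₁_single (A := intRep G) (g, h) a).trans (by simp)

theorem d₃₂_intRep_hom : (d₃₂ (intRep G)).hom = barBoundaryThree G := by
  refine Finsupp.lhom_ext fun ⟨g, h, k⟩ a => ?_
  exact (d₃₂_single (A := intRep G) (g, h, k) a).trans (by simp)

theorem mem_cycles₁_intRep (x : G →₀ IntCoeff.{u}) : x ∈ cycles₁ (intRep G) := by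
  rw [cycles₁_eq_top_of_isTrivial]; trivial

theorem mem_cycles₂_intRep (x : G × G →₀ IntCoeff.{u}) :
    x ∈ cycles₂ (intRep G) ↔ x ∈ LinearMap.ker (barBoundaryTwo G) := by
  rw [← d₂₁_intRep_hom]; rfl

theorem mem_boundaries₁_intRep (x : G →₀ IntCoeff.{u}) :
    x ∈ boundaries₁ (intRep G) ↔ x ∈ LinearMap.range (barBoundaryTwo G) := by
  rw [← d₂₁_intRep_hom]; rfl

theorem mem_boundaries₂_intRep (x : G × G →₀ IntCoeff.{u}) :
    x ∈ boundaries₂ (intRep G) ↔ x ∈ LinearMap.range (barBoundaryThree G) := by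
  rw [← d₃₂_intRep_hom]; rfl

/-- The class in `H₁(G, ℤ)` of a bar 1-chain; every 1-chain with trivial coefficients is a
cycle. -/
noncomputable def barClassOne (x : G →₀ IntCoeff.{u}) : groupHomology (intRep G) 1 :=
  H1π (intRep G) ⟨x, mem_cycles₁_intRep x⟩

/-- The class in `H₂(G, ℤ)` of a bar 2-cycle. -/
noncomputable def barClassTwo (x : G × G →₀ IntCoeff.{u})
    (hx : x ∈ LinearMap.ker (barBoundaryTwo G)) : groupHomology (intRep G) 2 :=
  H2π (intRep G) ⟨x, (mem_cycles₂_intRep x).2 hx⟩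

theorem barClassOne_surjective : Function.Surjective (barClassOne (G := G)) := fun y =>
  H1_induction_on y fun x => ⟨x.1, rfl⟩

theorem exists_barClassTwo_eq (y : groupHomology (intRep G) 2) : ∃ x hx, barClassTwo x hx = y :=
  H2_induction_on y fun x => ⟨x.1, (mem_cycles₂_intRep x.1).1 x.2, rfl⟩

theorem barClassOne_eq_iff (x y : G →₀ IntCoeff.{u}) :
    barClassOne x = barClassOne y ↔ x - y ∈ LinearMap.range (barBoundaryTwo G) := by
  rw [barClassOne, barClassOne, H1π_eq_iff, mem_boundaries₁_intRep]

theorem barClassTwo_eq_iff (x y : G × G →₀ IntCoeff.{u}) (hx hy) :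
    barClassTwo x hx = barClassTwo y hy ↔ x - y ∈ LinearMap.range (barBoundaryThree G) := by
  rw [barClassTwo, barClassTwo, H2π_eq_iff, mem_boundaries₂_intRep]

theorem chainsMap₁_intRep_hom (f : G →* H) :
    (chainsMap₁ (A := intRep G) (B := intRep H) f (𝟙 (intRep G))).hom = barMapOne f := by
  refine Finsupp.lhom_ext fun g a => ?_
  simp
  rfl

theorem chainsMap₂_intRep_hom (f : G →* H) :
    (chainsMap₂ (A := intRep G) (B := intRep H) f (𝟙 (intRep G))).hom = barMapTwo f := by
  refine Finsupp.lhom_ext fun g a => ?_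
  simp
  rfl

theorem barMapTwo_mem_ker (f : G →* H) {x : G × G →₀ IntCoeff.{u}}
    (hx : x ∈ LinearMap.ker (barBoundaryTwo G)) :
    barMapTwo f x ∈ LinearMap.ker (barBoundaryTwo H) := by
  rw [LinearMap.mem_ker] at hx ⊢
  rw [barBoundaryTwo_barMapTwo, hx, map_zero]

theorem integralHomologyMap_barClassOne (f : G →* H) (x : G →₀ IntCoeff.{u}) :
    integralHomologyMap f 1 (barClassOne x) = barClassOne (barMapOne f x) := by
  refine (H1π_comp_map_apply (A := intRep G) (B := intRep H) f (𝟙 (intRep G)) _).trans ?_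
  refine congrArg (H1π (intRep H)) (Subtype.ext ?_)
  exact congr($(chainsMap₁_intRep_hom f) x)

theorem integralHomologyMap_barClassTwo (f : G →* H) (x : G × G →₀ IntCoeff.{u}) (hx) :
    integralHomologyMap f 2 (barClassTwo x hx) =
      barClassTwo (barMapTwo f x) (barMapTwo_mem_ker f hx) := by
  refine (H2π_comp_map_apply (A := intRep G) (B := intRep H) f (𝟙 (intRep G)) _).trans ?_
  refine congrArg (H2π (intRep H)) (Subtype.ext ?_)
  exact congr($(chainsMap₂_intRep_hom f) x)

/-- A homomorphism is an `Hℤ`-map if and only if on bar chains it reflects 1-boundaries,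
is surjective on 1-chains modulo 1-boundaries, and on 2-cycles modulo 2-boundaries. -/
theorem isHZMap_iff (f : G →* H) : IsHZMap f ↔
    (∀ x, barMapOne f x ∈ LinearMap.range (barBoundaryTwo H) →
      x ∈ LinearMap.range (barBoundaryTwo G)) ∧
    (∀ y, ∃ x, barMapOne f x - y ∈ LinearMap.range (barBoundaryTwo H)) ∧
    (∀ z ∈ LinearMap.ker (barBoundaryTwo H), ∃ w ∈ LinearMap.ker (barBoundaryTwo G),
      barMapTwo f w - z ∈ LinearMap.range (barBoundaryThree H)) := by
  constructor
  · rintro ⟨⟨inj, surj⟩, surj2⟩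
    refine ⟨fun x hx => ?_, fun y => ?_, fun z hz => ?_⟩
    · rw [← sub_zero x, ← barClassOne_eq_iff]
      apply inj
      rw [integralHomologyMap_barClassOne, integralHomologyMap_barClassOne, barClassOne_eq_iff,
        map_zero, sub_zero]
      exact hx
    · obtain ⟨x', hx⟩ := surj (barClassOne y)
      obtain ⟨x, rfl⟩ := barClassOne_surjective x'
      rw [integralHomologyMap_barClassOne, barClassOne_eq_iff] at hx
      exact ⟨x, hx⟩
    · obtain ⟨x', hx⟩ := surj2 (barClassTwo z hz)
      obtain ⟨x, hx', rfl⟩ := exists_barClassTwo_eq x'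
      rw [integralHomologyMap_barClassTwo, barClassTwo_eq_iff] at hx
      exact ⟨x, hx', hx⟩
  · rintro ⟨h1, h2, h3⟩
    refine ⟨⟨fun a b hab => ?_, fun b => ?_⟩, fun b => ?_⟩
    · obtain ⟨x, rfl⟩ := barClassOne_surjective a
      obtain ⟨y, rfl⟩ := barClassOne_surjective b
      rw [integralHomologyMap_barClassOne, integralHomologyMap_barClassOne, barClassOne_eq_iff,
        ← map_sub] at hab
      exact (barClassOne_eq_iff _ _).2 (h1 _ hab)
    · obtain ⟨y, rfl⟩ := barClassOne_surjective b
      obtain ⟨x, hx⟩ := h2 y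
      exact ⟨barClassOne x, by rw [integralHomologyMap_barClassOne, barClassOne_eq_iff]; exact hx⟩
    · obtain ⟨y, hy, rfl⟩ := exists_barClassTwo_eq b
      obtain ⟨x, hx, hxy⟩ := h3 y hy
      exact ⟨barClassTwo x hx, by
        rw [integralHomologyMap_barClassTwo, barClassTwo_eq_iff]; exact hxy⟩
end

/-! ### Quotients by a normal subgroup `N = [N, G]` are `Hℤ`-maps -/

section
open scoped commutatorElement
variable {G Q : Type u} [Group G] [Group Q] (f : G →* Q)

theorem barMapTwo_single (g h : G) (a : IntCoeff.{u}) :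
    barMapTwo f (Finsupp.single (g, h) a) = Finsupp.single (f g, f h) a := by
  simp

/-- The bar 1-chains of `G` that are boundaries of 2-chains whose image in `Q` is a 2-boundary. -/
noncomputable def boundariesOverBoundaries : Submodule IntCoeff.{u} (G →₀ IntCoeff.{u}) :=
  ((LinearMap.range (barBoundaryThree Q)).comap (barMapTwo f)).map (barBoundaryTwo G)

variable {f}

theorem mem_boundariesOverBoundaries_of {x : G →₀ IntCoeff.{u}} (y : G × G →₀ IntCoeff.{u})
    (w : Q × Q × Q →₀ IntCoeff.{u}) (hy : barBoundaryTwo G y = x)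
    (hw : barBoundaryThree Q w = barMapTwo f y) : x ∈ boundariesOverBoundaries f :=
  ⟨y, ⟨w, hw⟩, hy⟩

/-- The elements `n` with `[n] - [1]` in the submodule form a subgroup; it contains the commutators
`⁅n, g⁆`, since `⁅n, g⁆ * (g * n) = n * g` and `[g, n] - [n, g]` bounds `[ng] - [gn]`. -/
theorem single_sub_single_one_mem (hN : f.ker ≤ ⁅f.ker, (⊤ : Subgroup G)⁆) {n : G}
    (hn : n ∈ f.ker) :
    Finsupp.single n 1 - Finsupp.single 1 1 ∈ boundariesOverBoundaries f := by
  have key : ∀ n ∈ ⁅f.ker, (⊤ : Subgroup G)⁆, n ∈ f.ker ∧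
      Finsupp.single n 1 - Finsupp.single 1 1 ∈ boundariesOverBoundaries f := by
    intro n hn
    rw [Subgroup.commutator_def] at hn
    induction hn using Subgroup.closure_induction with
    | mem c hc =>
      obtain ⟨n, hn, g, -, rfl⟩ := hc
      have hn' : f n = 1 := hn
      refine ⟨by simp [MonoidHom.mem_ker, commutatorElement_def, hn'], ?_⟩
      refine mem_boundariesOverBoundaries_of
        (Finsupp.single (⁅n, g⁆, g * n) 1 - Finsupp.single (1, 1) 1 +
          Finsupp.single (g, n) 1 - Finsupp.single (n, g) 1)
        (-Finsupp.single (f g, 1, 1) 1) ?_ ?_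
      · have : ⁅n, g⁆ * (g * n) = n * g := by simp [commutatorElement_def, mul_assoc]
        simp only [map_add, map_sub, barBoundaryTwo_single, this, mul_one]
        abel
      · simp only [map_sub, map_add, map_neg, barMapTwo_single, barBoundaryThree_single,
          commutatorElement_def, map_mul, map_inv, map_one, hn', mul_one, one_mul, inv_one,
          mul_inv_cancel]
        abel
    | one => exact ⟨one_mem _, by simp⟩
    | mul a b _ _ ha hb =>
      obtain ⟨ha', ha⟩ := ha
      obtain ⟨hb', hb⟩ := hb
      refine ⟨mul_mem ha' hb', ?_⟩
      have h := mem_boundariesOverBoundaries_of (f := f)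
        (Finsupp.single (a, b) 1 - Finsupp.single (1, 1) 1) 0 rfl
        (by rw [map_sub, barMapTwo_single, barMapTwo_single, MonoidHom.mem_ker.1 ha',
          MonoidHom.mem_ker.1 hb', map_one, sub_self, map_zero])
      convert sub_mem (add_mem ha hb) h using 1
      simp only [map_sub, barBoundaryTwo_single, mul_one]
      abel
    | inv a _ ha =>
      obtain ⟨ha', ha⟩ := ha
      refine ⟨inv_mem ha', ?_⟩
      have h := mem_boundariesOverBoundaries_of (f := f)
        (Finsupp.single (a, a⁻¹) 1 - Finsupp.single (1, 1) 1) 0 rfl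
        (by rw [map_sub, barMapTwo_single, barMapTwo_single, map_inv, MonoidHom.mem_ker.1 ha',
          inv_one, map_one, sub_self, map_zero])
      convert sub_mem h ha using 1
      simp only [map_sub, barBoundaryTwo_single, mul_one, mul_inv_cancel]
      abel
  exact (key n (hN hn)).2

theorem single_mul_sub_single_mem (hN : f.ker ≤ ⁅f.ker, (⊤ : Subgroup G)⁆) {n : G}
    (hn : n ∈ f.ker) (g : G) :
    Finsupp.single (g * n) 1 - Finsupp.single g 1 ∈ boundariesOverBoundaries f := by
  have h := mem_boundariesOverBoundaries_of (f := f)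
    (Finsupp.single (g, n) 1 - Finsupp.single (1, 1) 1) (-Finsupp.single (f g, 1, 1) 1) rfl
    (by
      simp only [map_sub, map_neg, barMapTwo_single, barBoundaryThree_single, map_one,
        MonoidHom.mem_ker.1 hn, mul_one]
      abel)
  convert sub_mem (single_sub_single_one_mem hN hn) h using 1
  simp only [map_sub, barBoundaryTwo_single, mul_one]
  abel

/-- The kernel on 1-chains is spanned by the differences `[gn] - [g]` with `n` in the kernel of
`f`. -/
theorem ker_barMapOne_le (hf : Function.Surjective f)
    (hN : f.ker ≤ ⁅f.ker, (⊤ : Subgroup G)⁆) :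
    LinearMap.ker (barMapOne f) ≤ boundariesOverBoundaries f := by
  obtain ⟨σ, hσ⟩ := hf.hasRightInverse
  have key (x : G →₀ IntCoeff.{u}) :
      Finsupp.lmapDomain IntCoeff.{u} IntCoeff.{u} (σ ∘ f) x - x ∈ boundariesOverBoundaries f := by
    induction x using Finsupp.induction_linear with
    | zero => simp
    | add x y hx hy =>
      rw [map_add, add_sub_add_comm]
      exact add_mem hx hy
    | single g a =>
      have h := single_mul_sub_single_mem hN (n := g⁻¹ * σ (f g))
        (by simp [MonoidHom.mem_ker, hσ (f g)]) g
      have := Submodule.smul_mem _ a h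
      simpa [smul_sub, Finsupp.mapDomain_single] using this
  intro x hx
  have h := key x
  rw [Finsupp.lmapDomain_comp, LinearMap.comp_apply, LinearMap.mem_ker.1 hx, map_zero, zero_sub]
    at h
  exact neg_mem_iff.1 h

/-- A surjection whose kernel `N` satisfies `N = [N, G]` is an `Hℤ`-map. On `H₂` this reflects the
exactness of `H₂(G) → H₂(G/N) → N/[N, G]`. -/
theorem isHZMap_of_surjective_of_ker_le (hf : Function.Surjective f)
    (hN : f.ker ≤ ⁅f.ker, (⊤ : Subgroup G)⁆) : IsHZMap f := by
  have s1 : Function.Surjective (barMapOne f) := Finsupp.mapDomain_surjective hf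
  have s2 : Function.Surjective (barMapTwo f) := Finsupp.mapDomain_surjective (hf.prodMap hf)
  refine (isHZMap_iff f).2 ⟨?_, ?_, ?_⟩
  · rintro x ⟨z, hz⟩
    obtain ⟨y, rfl⟩ := s2 z
    obtain ⟨y', -, hy'⟩ := ker_barMapOne_le hf hN (x := x - barBoundaryTwo G y) (by
      rw [LinearMap.mem_ker, map_sub, ← barBoundaryTwo_barMapTwo, hz, sub_self])
    exact ⟨y' + y, by rw [map_add, hy', sub_add_cancel]⟩
  · intro y
    obtain ⟨x, rfl⟩ := s1 y
    exact ⟨x, by simp⟩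
  · intro z hz
    obtain ⟨y, rfl⟩ := s2 z
    obtain ⟨y', hy', h⟩ := ker_barMapOne_le hf hN (x := barBoundaryTwo G y) (by
      rw [LinearMap.mem_ker, ← barBoundaryTwo_barMapTwo]; exact hz)
    refine ⟨y - y', by rw [LinearMap.mem_ker, map_sub, h, sub_self], ?_⟩
    rw [map_sub, sub_sub_cancel_left]
    exact neg_mem hy'
end

/-! ### Nilpotent groups are `Hℤ`-local -/

section
open scoped IsMulCommutative
variable {G H : Type u} [Group G] [Group H] {f : G →* H} {A : Type u} [AddCommGroup A]

/-- Along an `Hℤ`-map `f`, a 2-cocycle `c` on the target whose pullback is the coboundary of `b`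
is itself the coboundary of a cochain extending `b`. The extension exists because the 1-chains of
`H` are the pushout of the 1-chains of `G` and the 1-boundaries of `H` over the 1-boundaries
of `G`. -/
theorem IsHZMap.exists_cochain_of_cocycle (hf : IsHZMap f) (c : H → H → A)
    (hc : ∀ x y z, c y z - c (x * y) z + c x (y * z) - c x y = 0) (b : G → A)
    (hb : ∀ x y, c (f x) (f y) = b y - b (x * y) + b x) :
    ∃ b' : H → A, (∀ x y, c x y = b' y - b' (x * y) + b' x) ∧ ∀ x, b' (f x) = b x := by
  obtain ⟨h1, h2, h3⟩ := (isHZMap_iff f).1 hf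
  let cl : (H × H →₀ IntCoeff.{u}) →ₗ[IntCoeff.{u}] A :=
    Finsupp.linearCombination IntCoeff.{u} fun p => c p.1 p.2
  let bl : (G →₀ IntCoeff.{u}) →ₗ[IntCoeff.{u}] A := Finsupp.linearCombination IntCoeff.{u} b
  have cl_d3 : ∀ x, cl (barBoundaryThree H x) = 0 := by
    intro x
    induction x using Finsupp.induction_linear with
    | zero => simp
    | add x y hx hy => rw [map_add, map_add, hx, hy, add_zero]
    | single p a =>
      obtain ⟨x, y, z⟩ := p
      simp only [barBoundaryThree_single, map_add, map_sub, cl, Finsupp.linearCombination_single]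
      rw [← smul_sub, ← smul_add, ← smul_sub, hc, smul_zero]
  have cl_f2 : ∀ x, cl (barMapTwo f x) = bl (barBoundaryTwo G x) := by
    intro x
    induction x using Finsupp.induction_linear with
    | zero => simp
    | add x y hx hy => simp only [map_add, hx, hy]
    | single p a =>
      obtain ⟨x, y⟩ := p
      rw [barMapTwo_single]
      simp only [barBoundaryTwo_single, map_add, map_sub, cl, bl, Finsupp.linearCombination_single]
      rw [← smul_sub, ← smul_add, hb]
  have cl_ker : ∀ z, barBoundaryTwo H z = 0 → cl z = 0 := by
    intro z hz
    obtain ⟨w, hw, v, hv⟩ := h3 z hz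
    have : z = barMapTwo f w - barBoundaryThree H v := by rw [hv]; abel
    rw [this, map_sub, cl_f2, cl_d3, LinearMap.mem_ker.1 hw, map_zero, sub_zero]
  let Φ := (barMapOne f).coprod (barBoundaryTwo H)
  have hΦ : Function.Surjective Φ := by
    intro y
    obtain ⟨x, w, hw⟩ := h2 y
    exact ⟨(x, -w), by simp only [Φ, LinearMap.coprod_apply, map_neg, hw]; abel⟩
  have hker : LinearMap.ker Φ ≤ LinearMap.ker (bl.coprod cl) := by
    rintro ⟨x, w⟩ hxw
    simp only [Φ, LinearMap.mem_ker, LinearMap.coprod_apply] at hxw ⊢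
    obtain ⟨v, rfl⟩ := h1 x ⟨-w, by rw [map_neg, ← eq_neg_of_add_eq_zero_left hxw]⟩
    rw [← cl_f2, ← map_add]
    exact cl_ker _ (by rw [map_add, barBoundaryTwo_barMapTwo, hxw])
  let β : (H →₀ IntCoeff.{u}) →ₗ[IntCoeff.{u}] A :=
    (LinearMap.ker Φ).liftQ (bl.coprod cl) hker ∘ₗ (Φ.quotKerEquivOfSurjective hΦ).symm.toLinearMap
  have hβ : ∀ x w, β (barMapOne f x + barBoundaryTwo H w) = bl x + cl w := by
    intro x w
    have : (Φ.quotKerEquivOfSurjective hΦ).symm (barMapOne f x + barBoundaryTwo H w) =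
        (LinearMap.ker Φ).mkQ (x, w) := by
      rw [LinearEquiv.symm_apply_eq]
      simp [Φ]
    simp only [β]
    rw [LinearMap.comp_apply, LinearEquiv.coe_coe, this]
    simp
  refine ⟨fun y => β (Finsupp.single y 1), fun x y => ?_, fun x => ?_⟩
  · have := hβ 0 (Finsupp.single (x, y) 1)
    simp only [map_zero, zero_add, barBoundaryTwo_single, map_add, map_sub, cl,
      Finsupp.linearCombination_single, one_smul] at this
    exact this.symm
  · have := hβ (Finsupp.single x 1) 0
    simpa [bl] using this

/-- A homomorphism to an abelian group that vanishes on the image of an `Hℤ`-map vanishes, since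
that image generates `H₁`. -/
theorem IsHZMap.eq_zero_of_comp_eq_zero (hf : IsHZMap f) (d : H → A)
    (hd : ∀ x y, d (x * y) = d x + d y) (hfd : ∀ x, d (f x) = 0) (y : H) : d y = 0 := by
  obtain ⟨-, h2, -⟩ := (isHZMap_iff f).1 hf
  let dl : (H →₀ IntCoeff.{u}) →ₗ[IntCoeff.{u}] A := Finsupp.linearCombination IntCoeff.{u} d
  obtain ⟨x, w, hw⟩ := h2 (Finsupp.single y 1)
  have e1 : dl (barMapOne f x) = 0 := by
    clear hw
    induction x using Finsupp.induction_linear with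
    | zero => simp
    | add x y hx hy => rw [map_add, map_add, hx, hy, add_zero]
    | single g a => simp [dl, hfd]
  have e2 : dl (barBoundaryTwo H w) = 0 := by
    clear hw
    induction w using Finsupp.induction_linear with
    | zero => simp
    | add x y hx hy => rw [map_add, map_add, hx, hy, add_zero]
    | single p a =>
      obtain ⟨x, y⟩ := p
      simp only [barBoundaryTwo_single, map_add, map_sub, dl, Finsupp.linearCombination_single]
      rw [← smul_sub, ← smul_add, hd]
      simp
  have := congrArg dl hw
  rw [map_sub, e1, e2] at this
  simpa [dl] using this.symm

/-- Homomorphisms extend uniquely along an `Hℤ`-map into `Γ` as soon as they do into the quotient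
of `Γ` by its center. -/
theorem IsHZMap.bijective_comp_of_quotient_center (hf : IsHZMap f) (Γ : Type u) [Group Γ]
    (h : Function.Bijective fun g : H →* Γ ⧸ Subgroup.center Γ => g.comp f) :
    Function.Bijective fun g : H →* Γ => g.comp f := by
  let π := QuotientGroup.mk' (Subgroup.center Γ)
  have central : ∀ {x y : Γ}, π x = π y → x * y⁻¹ ∈ Subgroup.center Γ := by
    intro x y hxy
    rw [← QuotientGroup.ker_mk' (Subgroup.center Γ), MonoidHom.mem_ker, map_mul, map_inv]
    exact mul_inv_eq_one.2 hxy
  constructor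
  · intro g₁ g₂ (hg : g₁.comp f = g₂.comp f)
    have hπ : π.comp g₁ = π.comp g₂ := h.1 (by
      change (π.comp g₁).comp f = (π.comp g₂).comp f
      rw [MonoidHom.comp_assoc, hg, MonoidHom.comp_assoc])
    have hz (x : H) : g₁ x * (g₂ x)⁻¹ ∈ Subgroup.center Γ := central (DFunLike.congr_fun hπ x)
    ext y
    have := hf.eq_zero_of_comp_eq_zero (A := Additive (Subgroup.center Γ))
      (fun x => Additive.ofMul ⟨g₁ x * (g₂ x)⁻¹, hz x⟩) (fun x y => ?_) (fun x => ?_) y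
    · exact mul_inv_eq_one.1 (congrArg (fun a => ((Additive.toMul a : Subgroup.center Γ) : Γ)) this)
    · apply Additive.toMul.injective
      apply Subtype.ext
      change g₁ (x * y) * (g₂ (x * y))⁻¹ = g₁ x * (g₂ x)⁻¹ * (g₁ y * (g₂ y)⁻¹)
      rw [mul_assoc (g₁ x), (Subgroup.mem_center_iff.1 (hz y) (g₂ x)⁻¹)]
      simp [mul_assoc]
    · apply Additive.toMul.injective
      apply Subtype.ext
      exact mul_inv_eq_one.2 (DFunLike.congr_fun hg x)
  · intro k
    obtain ⟨h', hh' : h'.comp f = π.comp k⟩ := h.2 (π.comp k)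
    -- a set-theoretic lift `σ` of `h'`, with factor set `c`
    let σ : H → Γ := fun x => (h' x).out
    have hσ (x : H) : π (σ x) = h' x := QuotientGroup.out_eq' _
    have hcz (x y : H) : σ x * σ y * (σ (x * y))⁻¹ ∈ Subgroup.center Γ :=
      central (by rw [map_mul, hσ, hσ, hσ, map_mul])
    have hbz (x : G) : σ (f x) * (k x)⁻¹ ∈ Subgroup.center Γ :=
      central (by rw [hσ]; exact DFunLike.congr_fun hh' x)
    let c (x y : H) : Additive (Subgroup.center Γ) :=
      Additive.ofMul ⟨σ x * σ y * (σ (x * y))⁻¹, hcz x y⟩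
    let b (x : G) : Additive (Subgroup.center Γ) :=
      Additive.ofMul ⟨σ (f x) * (k x)⁻¹, hbz x⟩
    have hcoc (x y z : H) : c y z - c (x * y) z + c x (y * z) - c x y = 0 := by
      have hc (x y : H) : σ x * σ y * (σ (x * y))⁻¹ * σ (x * y) = σ x * σ y :=
        inv_mul_cancel_right _ _
      have key : (⟨_, hcz y z⟩ * ⟨_, hcz x (y * z)⟩ : Subgroup.center Γ) =
          ⟨_, hcz x y⟩ * ⟨_, hcz (x * y) z⟩ := by
        apply Subtype.ext
        apply mul_right_cancel (b := σ (x * y * z))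
        change (σ y * σ z * (σ (y * z))⁻¹) * (σ x * σ (y * z) * (σ (x * (y * z)))⁻¹) * _ =
          (σ x * σ y * (σ (x * y))⁻¹) * (σ (x * y) * σ z * (σ (x * y * z))⁻¹) * _
        rw [mul_assoc, mul_assoc x y z, hc, ← mul_assoc, ← Subgroup.mem_center_iff.1 (hcz y z),
          mul_assoc (σ x), hc, ← mul_assoc x y z, mul_assoc _ _ (σ (x * y * z)), hc,
          ← mul_assoc (σ x * σ y * (σ (x * y))⁻¹), hc, mul_assoc]
      have : c y z + c x (y * z) = c x y + c (x * y) z := congrArg Additive.ofMul key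
      rw [sub_add_eq_add_sub, this]
      abel
    have hcob (x y : G) : c (f x) (f y) = b y - b (x * y) + b x := by
      have key : (⟨_, hcz (f x) (f y)⟩ * ⟨_, hbz (x * y)⟩ : Subgroup.center Γ) =
          ⟨_, hbz x⟩ * ⟨_, hbz y⟩ := by
        apply Subtype.ext
        change σ (f x) * σ (f y) * (σ (f x * f y))⁻¹ * (σ (f (x * y)) * (k (x * y))⁻¹) =
          σ (f x) * (k x)⁻¹ * (σ (f y) * (k y)⁻¹)
        rw [mul_assoc (σ (f x)) (k x)⁻¹, Subgroup.mem_center_iff.1 (hbz y), map_mul, map_mul]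
        group
      have : c (f x) (f y) + b (x * y) = b x + b y := congrArg Additive.ofMul key
      rw [← eq_sub_iff_add_eq] at this
      rw [this]
      abel
    obtain ⟨b', hb', hb'f⟩ := hf.exists_cochain_of_cocycle c hcoc b hcob
    let β : H → Γ := fun x => ((b' x).toMul : Subgroup.center Γ)
    have hβ (x y : H) : σ x * σ y * (σ (x * y))⁻¹ = β y * (β (x * y))⁻¹ * β x := by
      have := congrArg (fun a => ((Additive.toMul a : Subgroup.center Γ) : Γ)) (hb' x y)
      simpa [β, c, div_eq_mul_inv] using this
    have hβf (x : G) : β (f x) = σ (f x) * (k x)⁻¹ := by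
      simp [β, b, hb'f]
    refine ⟨MonoidHom.mk' (fun x => (β x)⁻¹ * σ x) fun x y => ?_, ?_⟩
    · have hp : ∀ z, z * (β x)⁻¹ = (β x)⁻¹ * z := Subgroup.mem_center_iff.1
        (inv_mem ((b' x).toMul : Subgroup.center Γ).2)
      have hq : ∀ z, z * (β y)⁻¹ = (β y)⁻¹ * z := Subgroup.mem_center_iff.1
        (inv_mem ((b' y).toMul : Subgroup.center Γ).2)
      have e : σ (x * y) = (β x)⁻¹ * β (x * y) * (β y)⁻¹ * (σ x * σ y) := by
        have : σ x * σ y = (β y * (β (x * y))⁻¹ * β x) * σ (x * y) := by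
          rw [← hβ, inv_mul_cancel_right]
        rw [this]
        group
      rw [e, ← hp (β (x * y)), mul_assoc, mul_assoc, inv_mul_cancel_left,
        mul_assoc (β x)⁻¹, ← mul_assoc (σ x), hq (σ x), mul_assoc (β y)⁻¹]
    · ext x
      simp [hβf]

theorem isHZLocal_of_isNilpotent (Γ : Type u) [Group Γ] [Group.IsNilpotent Γ] : IsHZLocal Γ := by
  intro G H _ _ f hf
  refine Group.nilpotent_center_quotient_ind
    (P := fun Γ _ _ => Function.Bijective fun g : H →* Γ => g.comp f) Γ
    (fun Γ _ _ => ?_) (fun Γ _ _ ih => hf.bijective_comp_of_quotient_center Γ ih)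
  exact ⟨fun _ _ _ => MonoidHom.ext fun _ => Subsingleton.elim _ _,
    fun _ => ⟨1, MonoidHom.ext fun _ => Subsingleton.elim _ _⟩⟩

/-- If `N` is a normal subgroup with `N = [N, G]` and `G/N` is nilpotent, then `G/N` is the
`Hℤ`-localization of `G`. -/
theorem isHZLocalization_mk' (N : Subgroup G) [N.Normal] (hN : N ≤ ⁅N, (⊤ : Subgroup G)⁆)
    [Group.IsNilpotent (G ⧸ N)] : IsHZLocalization (QuotientGroup.mk' N) where
  isHZMap := isHZMap_of_surjective_of_ker_le (QuotientGroup.mk'_surjective N)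
    (by rwa [QuotientGroup.ker_mk'])
  isHZLocal := isHZLocal_of_isNilpotent _
end

/-! ### Finite stages of the transfinite lower central series -/

section
variable {G : Type u} [Group G]

theorem transfiniteLowerCentralSeries_natCast_add_one (n : ℕ) :
    transfiniteLowerCentralSeries G ((n : Ordinal.{u}) + 1) =
      (⊤ : Subgroup G).lowerCentralSeries n := by
  classical
  induction n with
  | zero =>
    unfold transfiniteLowerCentralSeries
    have := @Ordinal.limitRecOn_add_one (fun _ => Subgroup G) 0 ⊤
      (fun σ γ => if σ = 0 then ⊤ else ⁅γ, (⊤ : Subgroup G)⁆) (fun _ _ γ => ⨅ σ, ⨅ h, γ σ h)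
    simpa using this
  | succ n ih =>
    rw [Subgroup.lowerCentralSeries_succ, ← ih]
    conv_lhs => unfold transfiniteLowerCentralSeries
    rw [Ordinal.limitRecOn_add_one, if_neg (by simp)]
    rfl

/-- For a nilpotent group the terms of the transfinite lower central series vanish exactly from
the nilpotency class plus one onwards (the shift comes from the indexing `γ₁(G) = G`). -/
theorem isLeast_transfiniteLowerCentralSeries_eq_bot [Group.IsNilpotent G] :
    IsLeast {σ : Ordinal.{u} | 1 ≤ σ ∧ transfiniteLowerCentralSeries G σ = ⊥}
      ((Group.nilpotencyClass G : Ordinal.{u}) + 1) := by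
  refine ⟨⟨le_add_self, ?_⟩, fun σ ⟨h1, hσ⟩ => ?_⟩
  · rw [transfiniteLowerCentralSeries_natCast_add_one, Subgroup.lowerCentralSeries_nilpotencyClass]
  · rcases lt_or_ge σ Ordinal.omega0 with hlt | hge
    · obtain ⟨k, rfl⟩ := Ordinal.lt_omega0.1 hlt
      obtain ⟨n, rfl⟩ : ∃ n, k = n + 1 := 
        Nat.exists_eq_succ_of_ne_zero (Nat.one_le_iff_ne_zero.1 (by exact_mod_cast h1))
      rw [Nat.cast_add_one, transfiniteLowerCentralSeries_natCast_add_one,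
        Subgroup.lowerCentralSeries_eq_bot_iff_nilpotencyClass_le] at hσ
      exact_mod_cast Nat.succ_le_succ hσ
    · refine le_trans (le_of_lt ?_) hge
      rw [← Nat.cast_add_one]
      exact Ordinal.natCast_lt_omega0 (Group.nilpotencyClass G + 1)

/-- `Hℤ`-localizations are unique up to isomorphism. -/
theorem IsHZLocalization.nonempty_mulEquiv {E F : Type u} [Group E] [Group F] {η : G →* E}
    {θ : G →* F} (hη : IsHZLocalization η) (hθ : IsHZLocalization θ) : Nonempty (E ≃* F) := by
  obtain ⟨a, ha : a.comp η = θ⟩ := (hθ.isHZLocal G E η hη.isHZMap).2 θ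
  obtain ⟨b, hb : b.comp θ = η⟩ := (hη.isHZLocal G F θ hθ.isHZMap).2 η
  refine ⟨MonoidHom.toMulEquiv a b ?_ ?_⟩
  · apply (hη.isHZLocal G E η hη.isHZMap).1
    change (b.comp a).comp η = (MonoidHom.id E).comp η
    rw [MonoidHom.comp_assoc, ha, hb, MonoidHom.id_comp]
  · apply (hθ.isHZLocal G F θ hθ.isHZMap).1
    change (a.comp b).comp θ = (MonoidHom.id F).comp θ
    rw [MonoidHom.comp_assoc, hb, ha, MonoidHom.id_comp]

theorem nilpotencyClass_eq_of_mulEquiv {E F : Type*} [Group E] [Group F] [Group.IsNilpotent E]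
    [Group.IsNilpotent F] (e : E ≃* F) : Group.nilpotencyClass E = Group.nilpotencyClass F :=
  le_antisymm (Group.nilpotencyClass_le_of_surjective e.symm.toMonoidHom e.symm.surjective)
    (Group.nilpotencyClass_le_of_surjective e.toMonoidHom e.surjective)

theorem IsHZLocalization.hasHZLength {E : Type u} [Group E] [Group.IsNilpotent E] {η : G →* E}
    (hη : IsHZLocalization η) :
    HasHZLength G ((Group.nilpotencyClass E : Ordinal.{u}) + 1) := by
  refine ⟨⟨E, _, η, hη⟩, fun F _ θ hθ => ?_⟩
  obtain ⟨e⟩ := hη.nonempty_mulEquiv hθ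
  have := Group.nilpotent_of_mulEquiv e
  rw [nilpotencyClass_eq_of_mulEquiv e]
  exact isLeast_transfiniteLowerCentralSeries_eq_bot
end

/-! ### Central extensions of `M ⋊ C` by invariant bilinear maps -/

section
open scoped commutatorElement
variable {C : Type v} [CommGroup C] {M : Type u} [AddCommGroup M] [Module (MonoidAlgebra ℤ C) M]
  {A : Type*} [AddCommGroup A]

/-- The set underlying the central extension of `M ⋊ C` by `A` defined by a `C`-invariant
biadditive map `β : M → M → A`. -/
@[ext] structure TwistedExtension (C : Type v) [CommGroup C] {M : Type u} [AddCommGroup M]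
    [Module (MonoidAlgebra ℤ C) M] {A : Type*} [AddCommGroup A] (β : M →+ M →+ A)
    (hβ : ∀ (c : C) (u v : M),
      β (MonoidAlgebra.of ℤ C c • u) (MonoidAlgebra.of ℤ C c • v) = β u v) where
  /-- The central component. -/
  central : A
  /-- The component in the module. -/
  vec : M
  /-- The component in the acting group. -/
  act : C

namespace TwistedExtension

variable {β : M →+ M →+ A} {hβ : ∀ (c : C) (u v : M),
  β (MonoidAlgebra.of ℤ C c • u) (MonoidAlgebra.of ℤ C c • v) = β u v}

noncomputable instance : Mul (TwistedExtension C β hβ) where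
  mul x y := ⟨x.central + y.central + β x.vec (MonoidAlgebra.of ℤ C x.act • y.vec),
    x.vec + MonoidAlgebra.of ℤ C x.act • y.vec, x.act * y.act⟩

instance : One (TwistedExtension C β hβ) := ⟨⟨0, 0, 1⟩⟩

noncomputable instance : Inv (TwistedExtension C β hβ) where
  inv x := ⟨-x.central + β x.vec x.vec, -(MonoidAlgebra.of ℤ C x.act⁻¹ • x.vec), x.act⁻¹⟩

theorem mul_def (x y : TwistedExtension C β hβ) :
    x * y = ⟨x.central + y.central + β x.vec (MonoidAlgebra.of ℤ C x.act • y.vec),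
      x.vec + MonoidAlgebra.of ℤ C x.act • y.vec, x.act * y.act⟩ := rfl

theorem one_def : (1 : TwistedExtension C β hβ) = ⟨0, 0, 1⟩ := rfl

theorem inv_def (x : TwistedExtension C β hβ) :
    x⁻¹ = ⟨-x.central + β x.vec x.vec, -(MonoidAlgebra.of ℤ C x.act⁻¹ • x.vec), x.act⁻¹⟩ := rfl

noncomputable instance : Group (TwistedExtension C β hβ) :=
  Group.ofLeftAxioms
    (fun x y z => by
      ext
      · simp only [mul_def, map_add, AddMonoidHom.add_apply, smul_add, map_mul, mul_smul, hβ]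
        abel
      · simp only [mul_def, smul_add, map_mul, mul_smul]
        abel
      · simp only [mul_def, mul_assoc])
    (fun x => by ext <;> simp [-MonoidAlgebra.of_apply, mul_def, one_def])
    (fun x => by
      ext
      · simp [-MonoidAlgebra.of_apply, mul_def, one_def, inv_def, hβ]
      · simp [-MonoidAlgebra.of_apply, mul_def, one_def, inv_def]
      · simp [-MonoidAlgebra.of_apply, mul_def, one_def, inv_def])

/-- The projection of the extension onto `M ⋊ C`. -/
noncomputable def toSemidirect : TwistedExtension C β hβ →* ModuleSemidirect C M where
  toFun x := ⟨Multiplicative.ofAdd x.vec, x.act⟩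
  map_one' := rfl
  map_mul' _ _ := rfl

theorem toSemidirect_surjective : Function.Surjective (toSemidirect (β := β) (hβ := hβ)) :=
  fun x => ⟨⟨0, x.left.toAdd, x.right⟩, rfl⟩

theorem eq_of_toSemidirect_eq_one {x : TwistedExtension C β hβ} (hx : toSemidirect x = 1) :
    x = ⟨x.central, 0, 1⟩ :=
  TwistedExtension.ext rfl (congrArg (fun y : ModuleSemidirect C M => y.left.toAdd) hx)
    (congrArg (fun y : ModuleSemidirect C M => y.right) hx)

/-- The copy of `A` inside the extension. -/
noncomputable def ofCentral : Multiplicative A →* TwistedExtension C β hβ where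
  toFun a := ⟨a.toAdd, 0, 1⟩
  map_one' := rfl
  map_mul' a b := by ext <;> simp [-MonoidAlgebra.of_apply, mul_def]

theorem commute_of_toSemidirect_eq_one {x : TwistedExtension C β hβ} (hx : toSemidirect x = 1)
    (y : TwistedExtension C β hβ) : y * x = x * y := by
  rw [eq_of_toSemidirect_eq_one hx]
  ext
  · simp [-MonoidAlgebra.of_apply, mul_def, add_comm]
  · simp [-MonoidAlgebra.of_apply, mul_def]
  · simp [-MonoidAlgebra.of_apply, mul_def]

theorem commutator_mk (a b : A) (u v : M) :
    ⁅(⟨a, u, 1⟩ : TwistedExtension C β hβ), (⟨b, v, 1⟩ : TwistedExtension C β hβ)⁆ =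
      ⟨β u v - β v u, 0, 1⟩ := by
  rw [commutatorElement_def, mul_inv_eq_iff_eq_mul, mul_inv_eq_iff_eq_mul]
  ext
  · simp [-MonoidAlgebra.of_apply, mul_def]
    abel
  · simp [-MonoidAlgebra.of_apply, mul_def, add_comm]
  · simp [-MonoidAlgebra.of_apply, mul_def]

end TwistedExtension

open TwistedExtension in
/-- If `M ⋊ C` is finitely presented, the values `β u v - β v u` of an invariant biadditive map
lie in a finitely generated group: they are commutators in the central extension defined by `β`,
in which only finitely many central elements are needed to kill the image of a free group's
relators. -/
theorem exists_finite_closure_of_isFinitelyPresented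
    [hG : Group.IsFinitelyPresented (ModuleSemidirect C M)] (β : M →+ M →+ A)
    (hβ : ∀ (c : C) (u v : M),
      β (MonoidAlgebra.of ℤ C c • u) (MonoidAlgebra.of ℤ C c • v) = β u v) :
    ∃ S : Set A, S.Finite ∧ ∀ u v, β u v - β v u ∈ AddSubgroup.closure S := by
  obtain ⟨n, φ, hφ, R, hR, hRφ⟩ := hG.out
  let π := toSemidirect (C := C) (β := β) (hβ := hβ)
  obtain ⟨ψ, hψ⟩ : ∃ ψ : FreeGroup (Fin n) →* TwistedExtension C β hβ, π.comp ψ = φ := by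
    choose g hg using fun i => toSemidirect_surjective (β := β) (hβ := hβ) (φ (FreeGroup.of i))
    exact ⟨FreeGroup.lift g, by ext i <;> simp [π, hg]⟩
  have hψ' (x) : π (ψ x) = φ x := DFunLike.congr_fun hψ x
  let S : Set A := (fun x => (ψ x).central) '' R
  let P : Subgroup (TwistedExtension C β hβ) :=
    (AddSubgroup.toSubgroup (AddSubgroup.closure S) : Subgroup (Multiplicative A)).map ofCentral
  have hP : P.Normal := ⟨by
    rintro _ ⟨a, ha, rfl⟩ y
    rw [commute_of_toSemidirect_eq_one (x := ofCentral a) rfl, mul_inv_cancel_right]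
    exact ⟨a, ha, rfl⟩⟩
  have hker : φ.ker ≤ P.comap ψ := by
    rw [← hRφ]
    refine Subgroup.normalClosure_le_normal fun r hr => ?_
    have h1 : π (ψ r) = 1 := by
      rw [hψ', ← MonoidHom.mem_ker, ← hRφ]
      exact Subgroup.subset_normalClosure hr
    exact ⟨Multiplicative.ofAdd (ψ r).central, 
      show (ψ r).central ∈ AddSubgroup.closure S from AddSubgroup.subset_closure ⟨r, hr, rfl⟩,
      (eq_of_toSemidirect_eq_one h1).symm⟩
  refine ⟨S, hR.image _, fun u v => ?_⟩
  obtain ⟨x, hx⟩ := hφ ⟨Multiplicative.ofAdd u, 1⟩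
  obtain ⟨y, hy⟩ := hφ ⟨Multiplicative.ofAdd v, 1⟩
  have lift {x : FreeGroup (Fin n)} {u : M} (hx : φ x = ⟨Multiplicative.ofAdd u, 1⟩) :
      ψ x = ⟨(ψ x).central, u, 1⟩ := by
    rw [← hψ'] at hx
    exact TwistedExtension.ext rfl (congrArg (fun y : ModuleSemidirect C M => y.left.toAdd) hx)
      (congrArg (fun y : ModuleSemidirect C M => y.right) hx)
  have hmem : ⁅x, y⁆ ∈ φ.ker := by
    rw [MonoidHom.mem_ker, map_commutatorElement, hx, hy, commutatorElement_eq_one_iff_mul_comm]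
    ext
    · simp [mul_comm]
    · simp
  obtain ⟨a, ha, hae⟩ := hker hmem
  rw [map_commutatorElement, lift hx, lift hy, commutator_mk] at hae
  have : a.toAdd = β u v - β v u := congrArg TwistedExtension.central hae
  rw [← this]
  exact ha
end

/-! ### Tame modules are torsion modulo each prime -/

/-- A vector that is not killed by any nonzero polynomial in `T` is detected by an additive map to
the field of rational functions under which `T` becomes multiplication by the variable. -/
theorem exists_addMonoidHom_fractionRing {k V : Type*} [Field k] [AddCommGroup V] [Module k V]
    (T : Module.End k V) (v : V) (hv : ∀ p : k[X], p ≠ 0 → Polynomial.aeval T p v ≠ 0) :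
    ∃ φ : V →+ FractionRing k[X],
      (∀ u, φ (T u) = algebraMap k[X] (FractionRing k[X]) Polynomial.X * φ u) ∧ φ v ≠ 0 := by
  let W := Module.AEval' T
  let o : V →+ W := (Module.AEval'.of T).toLinearMap.toAddMonoidHom
  let L := LocalizedModule (nonZeroDivisors k[X]) W
  let ι : W →ₗ[k[X]] L := LocalizedModule.mkLinearMap _ _
  have hne : ι (o v) ≠ 0 := by
    intro h
    obtain ⟨s, hs⟩ := (IsLocalizedModule.eq_zero_iff (nonZeroDivisors k[X]) ι).1 h
    refine hv s (nonZeroDivisors.ne_zero s.2) ?_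
    apply (Module.AEval'.of T).injective
    rw [map_zero]
    exact (Module.AEval.of_aeval_smul (a := T) (s : k[X]) v).trans hs
  obtain ⟨g, hg⟩ := Module.Projective.exists_dual_ne_zero (FractionRing k[X]) hne
  refine ⟨(g.toAddMonoidHom.comp ι.toAddMonoidHom).comp o, fun u => ?_, hg⟩
  have h1 : o (T u) = (Polynomial.X : k[X]) • o u := (Module.AEval'.X_smul_of T u).symm
  change g (ι (o (T u))) = _ * g (ι (o u))
  rw [h1, ι.map_smul, ← algebraMap_smul (FractionRing k[X]) Polynomial.X (ι (o u)), map_smul,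
    smul_eq_mul]

/-- In characteristic `ℓ`, the elements `Xⁿ a - X⁻ⁿ b` with `a ≠ 0` are not contained in a
finitely generated subgroup, because this subgroup is finite while each value is taken at most
twice. -/
theorem eq_zero_of_forall_mem_closure {ℓ : ℕ} [Fact ℓ.Prime]
    (a b : FractionRing (ZMod ℓ)[X]) (S : Set (FractionRing (ZMod ℓ)[X])) (hS : S.Finite)
    (h : ∀ n : ℕ, algebraMap (ZMod ℓ)[X] (FractionRing (ZMod ℓ)[X]) Polynomial.X ^ n * a -
      (algebraMap (ZMod ℓ)[X] (FractionRing (ZMod ℓ)[X]) Polynomial.X)⁻¹ ^ n * b ∈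
        AddSubgroup.closure S) : a = 0 := by
  by_contra ha
  set z := algebraMap (ZMod ℓ)[X] (FractionRing (ZMod ℓ)[X]) Polynomial.X with hz
  have hz0 : z ≠ 0 := by
    rw [hz, Ne, IsFractionRing.to_map_eq_zero_iff]
    exact Polynomial.X_ne_zero
  have hinj : Function.Injective fun n : ℕ => z ^ n := by
    intro m n hmn
    simp only [hz, ← map_pow] at hmn
    have := congrArg Polynomial.natDegree (IsFractionRing.injective _ _ hmn)
    simpa using this
  have hfin : (AddSubgroup.closure S : Set (FractionRing (ZMod ℓ)[X])).Finite := by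
    have : Module.Finite (ZMod ℓ) (Submodule.span (ZMod ℓ) S) := Module.Finite.span_of_finite _ hS
    have : Finite (Submodule.span (ZMod ℓ) S) := Module.finite_of_finite (ZMod ℓ)
    exact (Set.toFinite (Submodule.span (ZMod ℓ) S : Set _)).subset
      (AddSubgroup.closure_le (K := (Submodule.span (ZMod ℓ) S).toAddSubgroup) |>.2
        Submodule.subset_span)
  -- two indices with the same value determine their sum, so no three indices share a value
  have key : ∀ m n : ℕ, m ≠ n → z ^ m * a - z⁻¹ ^ m * b = z ^ n * a - z⁻¹ ^ n * b →
      z ^ (m + n) * a = -b := by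
    intro m n hmn h
    have h2 : z ^ m - z ^ n ≠ 0 := sub_ne_zero.2 fun h => hmn (hinj h)
    apply mul_left_cancel₀ h2
    have hp : z ^ m ≠ 0 := pow_ne_zero _ hz0
    have hq : z ^ n ≠ 0 := pow_ne_zero _ hz0
    rw [pow_add]
    rw [inv_pow, inv_pow] at h
    generalize z ^ m = p at *
    generalize z ^ n = q at *
    field_simp at h
    linear_combination h
  have : Finite (AddSubgroup.closure S) := hfin
  obtain ⟨y, hy⟩ := Finite.exists_infinite_fiber
    (fun n : ℕ => (⟨_, h n⟩ : AddSubgroup.closure S))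
  have hy := Set.infinite_coe_iff.1 hy
  obtain ⟨i, hi⟩ := hy.nonempty
  obtain ⟨j, hj, hij⟩ := hy.exists_gt i
  obtain ⟨m, hm, hjm⟩ := hy.exists_gt j
  have e1 := key i j hij.ne (congrArg Subtype.val (hi.trans hj.symm))
  have e2 := key i m (hij.trans hjm).ne (congrArg Subtype.val (hi.trans hm.symm))
  have : i + j = i + m := hinj (mul_right_cancel₀ ha (e1.trans e2.symm))
  omega

section
variable {R M : Type*} [CommRing R] [AddCommGroup M] [Module R M]

theorem aeval_map_castRingHom_apply {ℓ : ℕ} [Module (ZMod ℓ) M] (T : Module.End (ZMod ℓ) M)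
    (t : R) (hT : ∀ u, T u = t • u) (p : ℤ[X]) (u : M) :
    Polynomial.aeval T (p.map (Int.castRingHom (ZMod ℓ))) u = Polynomial.aeval t p • u := by
  induction p using Polynomial.induction_on' with
  | add p q hp hq => simp only [Polynomial.map_add, map_add, LinearMap.add_apply, hp, hq, add_smul]
  | monomial n a =>
    have hpow : ∀ n : ℕ, (T ^ n) u = t ^ n • u := by
      intro n
      induction n with
      | zero => simp
      | succ n ih => rw [pow_succ', Module.End.mul_apply, ih, hT, smul_smul, pow_succ']
    rw [Polynomial.map_monomial, Polynomial.aeval_monomial, Polynomial.aeval_monomial,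
      Module.End.mul_apply, hpow, eq_intCast, map_intCast, eq_intCast, mul_smul,
      Int.cast_smul_eq_zsmul, Module.End.intCast_apply]

/-- In a module of exponent `ℓ`, an element that is killed by no integral polynomial in `t` that is
nonzero modulo `ℓ` is detected by an additive map to rational functions over `𝔽_ℓ` taking `t` to
the variable. -/
theorem exists_addMonoidHom_of_forall_aeval_smul_ne_zero {ℓ : ℕ} [Fact ℓ.Prime]
    (hM : ∀ y : M, ℓ • y = 0) (t : R) (x : M)
    (hx : ∀ p : ℤ[X], p.map (Int.castRingHom (ZMod ℓ)) ≠ 0 → Polynomial.aeval t p • x ≠ 0) :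
    ∃ φ : M →+ FractionRing (ZMod ℓ)[X],
      (∀ u, φ (t • u) = algebraMap (ZMod ℓ)[X] (FractionRing (ZMod ℓ)[X]) Polynomial.X * φ u) ∧
        φ x ≠ 0 := by
  let _ : Module (ZMod ℓ) M := AddCommGroup.zmodModule hM
  let T : Module.End (ZMod ℓ) M :=
    AddMonoidHom.toZModLinearMap ℓ (DistribSMul.toAddMonoidHom M t)
  refine exists_addMonoidHom_fractionRing T x fun p hp => ?_
  obtain ⟨q, rfl⟩ := Polynomial.map_surjective (Int.castRingHom (ZMod ℓ))
    (ZMod.ringHom_surjective _) p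
  rw [aeval_map_castRingHom_apply T t (fun _ => rfl)]
  exact hx q hp

/-- If no integral polynomial in `t` that is nonzero modulo `ℓ` sends `x` into `ℓ M`, then `x` is
detected by an additive map to rational functions over `𝔽_ℓ` taking `t` to the variable. -/
theorem exists_addMonoidHom_of_forall_aeval_smul {ℓ : ℕ} [Fact ℓ.Prime] (t : R) (x : M)
    (hx : ∀ p : ℤ[X], p.map (Int.castRingHom (ZMod ℓ)) ≠ 0 →
      ∀ y : M, Polynomial.aeval t p • x ≠ (ℓ : R) • y) :
    ∃ φ : M →+ FractionRing (ZMod ℓ)[X],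
      (∀ u, φ (t • u) = algebraMap (ZMod ℓ)[X] (FractionRing (ZMod ℓ)[X]) Polynomial.X * φ u) ∧
        φ x ≠ 0 := by
  let P : Submodule R M := LinearMap.range (LinearMap.lsmul R M (ℓ : R))
  have hP (y : M ⧸ P) : ℓ • y = 0 := by
    obtain ⟨y, rfl⟩ := P.mkQ_surjective y
    rw [← map_nsmul, Submodule.mkQ_apply, Submodule.Quotient.mk_eq_zero]
    exact ⟨y, by simp [Nat.cast_smul_eq_nsmul]⟩
  have hxP (p : ℤ[X]) (hp : p.map (Int.castRingHom (ZMod ℓ)) ≠ 0) :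
      Polynomial.aeval t p • P.mkQ x ≠ 0 := by
    intro h
    rw [← map_smul, Submodule.mkQ_apply, Submodule.Quotient.mk_eq_zero] at h
    obtain ⟨y, hy⟩ := h
    exact hx p hp y hy.symm
  obtain ⟨φ, hφ, hφx⟩ := exists_addMonoidHom_of_forall_aeval_smul_ne_zero hP t (P.mkQ x) hxP
  exact ⟨φ.comp P.mkQ.toAddMonoidHom, fun u => hφ (P.mkQ u), hφx⟩

/-- Reversing polynomials turns annihilation by a polynomial in `t⁻¹` into annihilation by a
polynomial in `t`. -/
theorem forall_aeval_inv_smul_of_forall {ℓ : ℕ} (t : Rˣ) (x : M)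
    (hx : ∀ p : ℤ[X], p.map (Int.castRingHom (ZMod ℓ)) ≠ 0 →
      ∀ y : M, Polynomial.aeval (t : R) p • x ≠ (ℓ : R) • y) (p : ℤ[X])
    (hp : p.map (Int.castRingHom (ZMod ℓ)) ≠ 0) (y : M) :
    Polynomial.aeval ((t⁻¹ : Rˣ) : R) p • x ≠ (ℓ : R) • y := by
  intro h
  refine hx (p.reflect p.natDegree) ?_ ((t : R) ^ p.natDegree • y) ?_
  · rwa [← Polynomial.reflect_map, Ne, Polynomial.reflect_eq_zero_iff]
  · let _ : Invertible ((t⁻¹ : Rˣ) : R) := (t⁻¹).invertible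
    have := Polynomial.eval₂_reflect_mul_pow (algebraMap ℤ R) ((t⁻¹ : Rˣ) : R) p.natDegree p le_rfl
    have ht : ⅟((t⁻¹ : Rˣ) : R) = (t : R) := by simp
    rw [ht] at this
    rw [smul_comm, ← h, Polynomial.aeval_def, Polynomial.aeval_def, ← this, smul_smul,
      mul_comm _ (((t⁻¹ : Rˣ) : R) ^ _), ← mul_assoc, ← mul_pow, Units.mul_inv, one_pow, one_mul]
end

section
variable {C : Type v} [CommGroup C] {M : Type u} [AddCommGroup M] [Module (MonoidAlgebra ℤ C) M]

/-- If `M ⋊ C` is finitely presented, then `M / ℓ M` is a torsion module over `𝔽_ℓ[t]`. -/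
theorem IsTame.exists_polynomial_smul_eq (hM : IsTame C M) {t : C}
    (ht : ∀ c : C, c ∈ Subgroup.zpowers t) (ℓ : ℕ) [Fact ℓ.Prime] (x : M) :
    ∃ p : ℤ[X], p.map (Int.castRingHom (ZMod ℓ)) ≠ 0 ∧
      ∃ y : M, Polynomial.aeval (MonoidAlgebra.of ℤ C t) p • x = (ℓ : MonoidAlgebra ℤ C) • y := by
  by_contra! hx
  let τ : (MonoidAlgebra ℤ C)ˣ := (MonoidAlgebra.of ℤ C).toHomUnits t
  have hτ : (τ : MonoidAlgebra ℤ C) = MonoidAlgebra.of ℤ C t := rfl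
  have hτ' : ((τ⁻¹ : (MonoidAlgebra ℤ C)ˣ) : MonoidAlgebra ℤ C) = MonoidAlgebra.of ℤ C t⁻¹ := rfl
  obtain ⟨φ, hφ, hφx⟩ := exists_addMonoidHom_of_forall_aeval_smul (τ : MonoidAlgebra ℤ C) x hx
  obtain ⟨θ, hθ, hθx⟩ := exists_addMonoidHom_of_forall_aeval_smul
    ((τ⁻¹ : (MonoidAlgebra ℤ C)ˣ) : MonoidAlgebra ℤ C) x (forall_aeval_inv_smul_of_forall τ x hx)
  set z := algebraMap (ZMod ℓ)[X] (FractionRing (ZMod ℓ)[X]) Polynomial.X with hz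
  have hz0 : z ≠ 0 := by
    rw [hz, Ne, IsFractionRing.to_map_eq_zero_iff]
    exact Polynomial.X_ne_zero
  have hθ' (u : M) : θ (MonoidAlgebra.of ℤ C t • u) = z⁻¹ * θ u := by
    rw [eq_inv_mul_iff_mul_eq₀ hz0, ← hθ, smul_smul, hτ', ← map_mul, inv_mul_cancel, map_one,
      one_smul]
  let β : M →+ M →+ FractionRing (ZMod ℓ)[X] := (AddMonoidHom.mul.compl₂ θ).comp φ
  have hβ_apply (u v : M) : β u v = φ u * θ v := rfl
  have hβt (u v : M) :
      β (MonoidAlgebra.of ℤ C t • u) (MonoidAlgebra.of ℤ C t • v) = β u v := by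
    rw [hβ_apply, hβ_apply, hθ', ← hτ, hφ]
    field_simp
  have hβ (c : C) : ∀ u v : M,
      β (MonoidAlgebra.of ℤ C c • u) (MonoidAlgebra.of ℤ C c • v) = β u v := by
    obtain ⟨n, rfl⟩ := ht c
    have hinv (u : M) : MonoidAlgebra.of ℤ C t • MonoidAlgebra.of ℤ C t⁻¹ • u = u := by
      rw [smul_smul, ← map_mul, mul_inv_cancel, map_one, one_smul]
    induction n using Int.induction_on with
    | zero => intro u v; simp only [zpow_zero, map_one, one_smul]
    | succ n ih => intro u v; simp only [zpow_add_one, map_mul, mul_smul] at ih ⊢; rw [ih, hβt]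
    | pred n ih =>
      intro u v
      simp only [zpow_sub_one, map_mul, mul_smul] at ih ⊢
      rw [ih, ← hβt, hinv, hinv]
  have := hM.finitelyPresented
  obtain ⟨S, hS, hmem⟩ := exists_finite_closure_of_isFinitelyPresented β hβ
  have hφn (n : ℕ) : φ (MonoidAlgebra.of ℤ C t ^ n • x) = z ^ n * φ x := by
    induction n with
    | zero => simp
    | succ n ih => rw [pow_succ', mul_smul, ← hτ, hφ, hτ, ih, pow_succ', mul_assoc]
  have hθn (n : ℕ) : θ (MonoidAlgebra.of ℤ C t ^ n • x) = z⁻¹ ^ n * θ x := by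
    induction n with
    | zero => simp
    | succ n ih => rw [pow_succ', mul_smul, hθ', ih, pow_succ', mul_assoc]
  have h0 := eq_zero_of_forall_mem_closure (φ x * θ x) (φ x * θ x) S hS fun n => by
    have := hmem (MonoidAlgebra.of ℤ C t ^ n • x) x
    rw [hβ_apply, hβ_apply, hφn, hθn] at this
    convert this using 1
    ring
  exact mul_ne_zero hφx hθx h0
end

/-! ### Stabilization of the powers of `t - 1` -/

section
variable {R M : Type*} [CommRing R] [AddCommGroup M] [Module R M]

theorem exists_eq_top_of_monotone [Module.Finite R M] {S : ℕ → Submodule R M} (hS : Monotone S)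
    (h : ∀ x, ∃ n, x ∈ S n) : ∃ n, S n = ⊤ := by
  obtain ⟨T, hT⟩ := (Module.Finite.fg_top : (⊤ : Submodule R M).FG)
  choose n hn using h
  refine ⟨T.sup n, top_le_iff.1 ?_⟩
  rw [← hT, Submodule.span_le]
  exact fun x hx => hS (Finset.le_sup hx) (hn x)

/-- An integral polynomial that is nonzero modulo a prime `ℓ` is, modulo `ℓ`, a power of `X - 1`
times a polynomial whose value at `1` is a unit. -/
theorem exists_eq_X_sub_one_pow_mul_add {ℓ : ℕ} [Fact ℓ.Prime] (p : ℤ[X])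
    (hp : p.map (Int.castRingHom (ZMod ℓ)) ≠ 0) :
    ∃ (a : ℕ) (q r : ℤ[X]), p = (Polynomial.X - 1) ^ a * q + Polynomial.C (ℓ : ℤ) * r ∧
      IsCoprime (q.eval 1) (ℓ : ℤ) := by
  obtain ⟨q, hq, hdvd⟩ := Polynomial.exists_eq_pow_rootMultiplicity_mul_and_not_dvd _ hp 1
  obtain ⟨q, rfl⟩ := Polynomial.map_surjective (Int.castRingHom (ZMod ℓ))
    (ZMod.ringHom_surjective _) q
  set a := Polynomial.rootMultiplicity 1 (p.map (Int.castRingHom (ZMod ℓ)))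
  have h : Polynomial.C (ℓ : ℤ) ∣ p - (Polynomial.X - 1) ^ a * q := by
    rw [Polynomial.C_dvd_iff_dvd_coeff]
    intro i
    rw [← ZMod.intCast_zmod_eq_zero_iff_dvd, ← eq_intCast (Int.castRingHom (ZMod ℓ)),
      ← Polynomial.coeff_map, Polynomial.map_sub, hq]
    simp
  obtain ⟨r, hr⟩ := h
  refine ⟨a, q, r, by rw [← hr]; ring, ?_⟩
  rw [isCoprime_comm, Prime.coprime_iff_not_dvd (Nat.prime_iff_prime_int.1 Fact.out),
    ← ZMod.intCast_zmod_eq_zero_iff_dvd]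
  rw [Polynomial.dvd_iff_isRoot, Polynomial.IsRoot.def, Polynomial.eval_map] at hdvd
  rw [Polynomial.eval₂_at_one, eq_intCast] at hdvd
  exact hdvd

theorem exists_eval_one_add (q : ℤ[X]) :
    ∃ h : ℤ[X], q = Polynomial.C (q.eval 1) + (Polynomial.X - 1) * h := by
  obtain ⟨h, hh⟩ := Polynomial.X_sub_C_dvd_sub_C_eval (a := 1) (p := q)
  exact ⟨h, by rw [← Polynomial.C_1, ← hh]; ring⟩

theorem exists_pow_smul_eq_of_aeval_smul {ℓ : ℕ} [Fact ℓ.Prime] (t : R) (x y : M) (p : ℤ[X])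
    (hp : p.map (Int.castRingHom (ZMod ℓ)) ≠ 0) (h : Polynomial.aeval t p • x = (ℓ : R) • y) :
    ∃ (n : ℕ) (u v : M), (t - 1) ^ n • x = (t - 1) ^ (n + 1) • u + (ℓ : R) • v := by
  obtain ⟨a, q, r, rfl, d, k, hdk⟩ := exists_eq_X_sub_one_pow_mul_add p hp
  obtain ⟨g, hg⟩ := exists_eval_one_add q
  have hq := congrArg (Polynomial.aeval t) hg
  have hdk := congrArg (Int.cast : ℤ → R) hdk
  simp only [map_add, map_mul, map_sub, map_pow, map_one, map_intCast, map_natCast,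
    Polynomial.aeval_X,
    eq_intCast, Int.cast_natCast, Int.cast_add, Int.cast_mul, Int.cast_one]
    at hq h hdk
  generalize Polynomial.aeval t q = Q at *
  generalize Polynomial.aeval t g = g at *
  generalize Polynomial.aeval t r = r at *
  generalize ((q.eval 1 : ℤ) : R) = w at *
  refine ⟨a, -((d : R) * g) • x, (d : R) • y - ((d : R) * r) • x + ((k : R) * (t - 1) ^ a) • x, ?_⟩
  rw [pow_succ]
  subst hq
  linear_combination (norm := module) (d : R) • h - hdk • ((t - 1) ^ a • x)

theorem exists_pow_smul_eq_add_iterate {s e : R} {n : ℕ}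
    (h : ∀ x : M, ∃ u v : M, s ^ n • x = s ^ (n + 1) • u + e • v) (j : ℕ) (x : M) :
    ∃ u v : M, s ^ n • x = s ^ (n + j) • u + e • v := by
  induction j with
  | zero => exact ⟨x, 0, by simp⟩
  | succ j ih =>
    obtain ⟨u, v, huv⟩ := ih
    obtain ⟨u', v', huv'⟩ := h u
    refine ⟨u', v + s ^ j • v', ?_⟩
    simp only [pow_add, pow_one] at *
    linear_combination (norm := module) huv + (s ^ j) • huv'

/-- If `sⁿ M ⊆ sⁿ⁺¹ M + ℓ M` holds for large `n` for every prime `ℓ`, it holds with any positive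
integer in place of `ℓ`. -/
theorem exists_forall_pow_smul_eq_add (s : R)
    (h : ∀ ℓ : ℕ, ℓ.Prime → ∃ n, ∀ x : M, ∃ u v : M, s ^ n • x = s ^ (n + 1) • u + (ℓ : R) • v)
    (e : ℕ) (he : e ≠ 0) :
    ∃ n, ∀ x : M, ∃ u v : M, s ^ n • x = s ^ (n + 1) • u + (e : R) • v := by
  induction e using induction_on_primes with
  | zero => exact absurd rfl he
  | one => exact ⟨0, fun x => ⟨0, x, by simp⟩⟩
  | prime_mul ℓ e hℓ ih =>
    obtain ⟨n₁, h₁⟩ := h ℓ hℓ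
    obtain ⟨n₂, h₂⟩ := ih (right_ne_zero_of_mul he)
    refine ⟨n₁ + n₂, fun x => ?_⟩
    obtain ⟨y, z, hyz⟩ := h₁ x
    obtain ⟨w, w', hw⟩ := exists_pow_smul_eq_add_iterate h₂ (n₁ + 1) z
    refine ⟨y + (ℓ : R) • w, w', ?_⟩
    push_cast
    simp only [pow_add, pow_one] at *
    linear_combination (norm := module) (s ^ n₂) • hyz + (ℓ : R) • hw

/-- The value `f(1) = ±1` makes `f(t)` invertible modulo `t - 1`, so a module killed by
`e (t - 1)ᵐ f(t)` needs stabilization of the powers of `t - 1` only modulo `e`. -/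
theorem exists_pow_smul_eq_of_torsion (t : R) (m : ℕ) (f : ℤ[X])
    (hf : f.eval 1 = 1 ∨ f.eval 1 = -1) (e : R)
    (he : ∀ x : M, e • Polynomial.aeval t ((Polynomial.X - 1) ^ m * f) • x = 0) (n : ℕ)
    (h : ∀ x : M, ∃ u v : M, (t - 1) ^ n • x = (t - 1) ^ (n + 1) • u + e • v) :
    ∃ n : ℕ, ∀ x : M, ∃ u : M, (t - 1) ^ n • x = (t - 1) ^ (n + 1) • u := by
  obtain ⟨g, hg⟩ := exists_eval_one_add f
  have hF := congrArg (Polynomial.aeval t) hg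
  simp only [map_add, map_mul, map_sub, map_pow, map_one, map_intCast,
    Polynomial.aeval_X,
    eq_intCast] at hF he
  refine ⟨n + m, fun x => ?_⟩
  obtain ⟨u, v, huv⟩ := h x
  have h2 : ((f.eval 1 : ℤ) : R) * ((f.eval 1 : ℤ) : R) = 1 := by
    rcases hf with h | h <;> simp [h]
  generalize Polynomial.aeval t f = F at *
  generalize Polynomial.aeval t g = g at *
  generalize ((f.eval 1 : ℤ) : R) = w at *
  refine ⟨w • (F • u - g • x), ?_⟩
  simp only [pow_add, pow_one] at *
  have hv := he v
  linear_combination (norm := module) (w * (t - 1) ^ m * F) • huv + w • hv -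
    (w * (t - 1) ^ n * (t - 1) ^ m) • (hF • x) - h2 • (((t - 1) ^ n * (t - 1) ^ m) • x)
end

/-! ### Prenilpotency -/

section
open scoped commutatorElement
variable {C : Type v} [CommGroup C] {M : Type u} [AddCommGroup M] [Module (MonoidAlgebra ℤ C) M]

theorem of_sub_one_mem_augmentationIdeal (c : C) :
    MonoidAlgebra.of ℤ C c - 1 ∈ augmentationIdeal C := by
  rw [augmentationIdeal, RingHom.mem_ker]
  simp

theorem augmentationIdeal_eq_span {t : C} (ht : ∀ c : C, c ∈ Subgroup.zpowers t) :
    augmentationIdeal C = Ideal.span {MonoidAlgebra.of ℤ C t - 1} := by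
  refine le_antisymm (fun r hr => ?_) ?_
  · set J := Ideal.span {MonoidAlgebra.of ℤ C t - 1}
    let q : C →* MonoidAlgebra ℤ C ⧸ J :=
      (Ideal.Quotient.mk J : MonoidAlgebra ℤ C →* MonoidAlgebra ℤ C ⧸ J).comp
        (MonoidAlgebra.of ℤ C)
    have hq (c : C) : Ideal.Quotient.mk J (MonoidAlgebra.of ℤ C c) = 1 := by
      have : Subgroup.zpowers t ≤ q.ker := by
        rw [Subgroup.zpowers_le, MonoidHom.mem_ker]
        refine (Ideal.Quotient.mk_eq_mk_iff_sub_mem _ _).2 ?_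
        exact Ideal.subset_span rfl
      exact this (ht c)
    have hmk : Ideal.Quotient.mk J =
        (Int.castRingHom (MonoidAlgebra ℤ C ⧸ J)).comp
          (MonoidAlgebra.lift ℤ ℤ C (1 : C →* ℤ)).toRingHom := by
      apply MonoidAlgebra.ringHom_ext
      · intro n
        have : MonoidAlgebra.single (1 : C) n = (n : MonoidAlgebra ℤ C) := by
          simp [MonoidAlgebra.intCast_def]
        rw [this, map_intCast, map_intCast]
      · intro c
        rw [← MonoidAlgebra.of_apply, hq]
        simp
    rw [← Ideal.Quotient.eq_zero_iff_mem, hmk]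
    have : MonoidAlgebra.lift ℤ ℤ C (1 : C →* ℤ) r = 0 := hr
    simp [this]
  · rw [Ideal.span_singleton_le_iff_mem]
    exact of_sub_one_mem_augmentationIdeal t

theorem mem_augmentationIdeal_pow_smul_top {t : C} (ht : ∀ c : C, c ∈ Subgroup.zpowers t) (n : ℕ)
    (x : M) : x ∈ augmentationIdeal C ^ n • (⊤ : Submodule (MonoidAlgebra ℤ C) M) ↔
      ∃ y, (MonoidAlgebra.of ℤ C t - 1) ^ n • y = x := by
  rw [augmentationIdeal_eq_span ht, Ideal.span_singleton_pow, Submodule.ideal_span_singleton_smul,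
    Submodule.mem_smul_pointwise_iff_exists]
  simp

theorem isPrenilpotent_of_pow_smul {t : C} (ht : ∀ c : C, c ∈ Subgroup.zpowers t) (n : ℕ)
    (h : ∀ x : M, ∃ u : M, (MonoidAlgebra.of ℤ C t - 1) ^ n • x =
      (MonoidAlgebra.of ℤ C t - 1) ^ (n + 1) • u) : IsPrenilpotent C M := by
  refine ⟨n, fun k hk => le_antisymm (fun x hx => ?_) ?_⟩
  · rw [mem_augmentationIdeal_pow_smul_top ht] at hx ⊢
    obtain ⟨y, rfl⟩ := hx
    obtain ⟨z, hz⟩ := h y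
    refine ⟨z, ?_⟩
    obtain ⟨j, rfl⟩ := Nat.exists_eq_add_of_le hk
    rw [add_comm n j, pow_add _ j n, mul_smul, hz, smul_smul, ← pow_add, add_assoc]
  · exact Submodule.smul_mono_left (Ideal.pow_le_pow_right k.le_succ)

theorem aeval_rationalAction_tmul (t : C) (p : ℤ[X]) (x : M) :
    Polynomial.aeval (rationalAction M t) (p.map (Int.castRingHom ℚ)) (1 ⊗ₜ[ℤ] x) =
      1 ⊗ₜ[ℤ] (Polynomial.aeval (MonoidAlgebra.of ℤ C t) p • x) := by
  induction p using Polynomial.induction_on' with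
  | add p q hp hq =>
    simp only [Polynomial.map_add, map_add, LinearMap.add_apply, hp, hq, add_smul,
      TensorProduct.tmul_add]
  | monomial n a =>
    have hpow : ∀ n : ℕ, (rationalAction M t ^ n) (1 ⊗ₜ[ℤ] x) =
        1 ⊗ₜ[ℤ] (MonoidAlgebra.of ℤ C t ^ n • x) := by
      intro n
      induction n with
      | zero => simp
      | succ n ih =>
        rw [pow_succ', Module.End.mul_apply, ih, rationalAction_tmul, smul_smul, pow_succ']
    rw [Polynomial.map_monomial, Polynomial.aeval_monomial, Polynomial.aeval_monomial,
      Module.End.mul_apply, hpow, eq_intCast, map_intCast, eq_intCast, mul_smul,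
      Int.cast_smul_eq_zsmul, Module.End.intCast_apply]
    exact (TensorProduct.tmul_smul a (1 : ℚ) (MonoidAlgebra.of ℤ C t ^ n • x)).symm

theorem exists_nsmul_eq_zero_of_one_tmul_eq_zero {y : M} (hy : (1 : ℚ) ⊗ₜ[ℤ] y = 0) :
    ∃ e : ℕ, e ≠ 0 ∧ e • y = 0 := by
  have : IsLocalizedModule (nonZeroDivisors ℤ) (TensorProduct.mk ℤ ℚ M 1) := inferInstance
  obtain ⟨s, hs⟩ :=
    (IsLocalizedModule.eq_zero_iff (nonZeroDivisors ℤ) (TensorProduct.mk ℤ ℚ M 1)).1 hy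
  refine ⟨(s : ℤ).natAbs, Int.natAbs_ne_zero.2 (nonZeroDivisors.ne_zero s.2), ?_⟩
  rw [← natCast_zsmul, Int.natCast_natAbs]
  have hs : (s : ℤ) • y = 0 := hs
  rcases abs_choice (s : ℤ) with h | h <;> simp [h, hs]

theorem exists_nat_smul_aeval_smul_eq_zero [Module.Finite (MonoidAlgebra ℤ C) M] (t : C) (p : ℤ[X])
    (hp : minpoly ℚ (rationalAction M t) = p.map (Int.castRingHom ℚ)) :
    ∃ e : ℕ, e ≠ 0 ∧ ∀ x : M,
      (e : MonoidAlgebra ℤ C) • Polynomial.aeval (MonoidAlgebra.of ℤ C t) p • x = 0 := by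
  -- factorials turn divisibility of annihilators into a monotone family
  obtain ⟨n, hn⟩ := exists_eq_top_of_monotone (R := MonoidAlgebra ℤ C) (M := M)
    (S := fun n => LinearMap.ker (LinearMap.lsmul (MonoidAlgebra ℤ C) M
      ((n.factorial : MonoidAlgebra ℤ C) * Polynomial.aeval (MonoidAlgebra.of ℤ C t) p)))
    (fun a b hab x hx => by
      obtain ⟨d, hd⟩ := Nat.factorial_dvd_factorial hab
      simp only [LinearMap.mem_ker, LinearMap.lsmul_apply] at hx ⊢
      rw [hd, Nat.cast_mul, mul_comm (a.factorial : MonoidAlgebra ℤ C), mul_assoc, mul_smul, hx,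
        smul_zero])
    (fun x => by
      obtain ⟨e, he, hex⟩ := exists_nsmul_eq_zero_of_one_tmul_eq_zero
        (y := Polynomial.aeval (MonoidAlgebra.of ℤ C t) p • x) (by
          rw [← aeval_rationalAction_tmul, ← hp, minpoly.aeval, LinearMap.zero_apply])
      obtain ⟨d, hd⟩ := Nat.dvd_factorial (Nat.pos_of_ne_zero he) le_rfl
      refine ⟨e, ?_⟩
      rw [LinearMap.mem_ker, LinearMap.lsmul_apply, hd, Nat.cast_mul,
        mul_comm (e : MonoidAlgebra ℤ C), mul_assoc, mul_smul, mul_smul,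
        Nat.cast_smul_eq_nsmul _ e, hex, smul_zero])
  refine ⟨n.factorial, n.factorial_ne_zero, fun x => ?_⟩
  have hx : x ∈ (⊤ : Submodule (MonoidAlgebra ℤ C) M) := trivial
  rw [← hn] at hx
  rw [← mul_smul]
  exact hx

/-- The descending chain of the submodules `(t - 1)ⁿ M` becomes stationary. -/
theorem IsTame.exists_pow_smul_eq (hM : IsTame C M) {t : C}
    (ht : ∀ c : C, c ∈ Subgroup.zpowers t) (m : ℕ) (f : ℤ[X])
    (hμ : minpoly ℚ (rationalAction M t) =
      ((Polynomial.X - 1) ^ m * f).map (Int.castRingHom ℚ))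
    (hf : f.eval 1 = 1 ∨ f.eval 1 = -1) :
    ∃ n : ℕ, ∀ x : M, ∃ u : M, (MonoidAlgebra.of ℤ C t - 1) ^ n • x =
      (MonoidAlgebra.of ℤ C t - 1) ^ (n + 1) • u := by
  have := hM.finite
  set s := MonoidAlgebra.of ℤ C t - 1 with hs
  have hprime (ℓ : ℕ) (hℓ : ℓ.Prime) :
      ∃ n, ∀ x : M, ∃ u v : M, s ^ n • x = s ^ (n + 1) • u + (ℓ : MonoidAlgebra ℤ C) • v := by
    have := Fact.mk hℓ
    obtain ⟨n, hn⟩ := exists_eq_top_of_monotone (R := MonoidAlgebra ℤ C) (M := M)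
      (S := fun n => (LinearMap.range (LinearMap.lsmul (MonoidAlgebra ℤ C) M (s ^ (n + 1))) ⊔
        LinearMap.range (LinearMap.lsmul (MonoidAlgebra ℤ C) M (ℓ : MonoidAlgebra ℤ C))).comap
          (LinearMap.lsmul (MonoidAlgebra ℤ C) M (s ^ n)))
      (monotone_nat_of_le_succ fun n x hx => by
        obtain ⟨_, ⟨u, rfl⟩, _, ⟨v, rfl⟩, huv⟩ := Submodule.mem_sup.1 hx
        refine Submodule.mem_sup.2 ⟨_, ⟨u, rfl⟩, _, ⟨s • v, rfl⟩, ?_⟩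
        simp only [LinearMap.lsmul_apply] at huv ⊢
        rw [pow_succ' s n, mul_smul s (s ^ n), ← huv, smul_add, smul_smul s (s ^ (n + 1)),
          ← pow_succ', smul_comm s])
      (fun x => by
        obtain ⟨p, hp, y, hy⟩ := hM.exists_polynomial_smul_eq ht ℓ x
        obtain ⟨n, u, v, h⟩ := exists_pow_smul_eq_of_aeval_smul _ x y p hp hy
        exact ⟨n, Submodule.mem_sup.2 ⟨_, ⟨u, rfl⟩, _, ⟨v, rfl⟩, h.symm⟩⟩)
    refine ⟨n, fun x => ?_⟩
    have hx : x ∈ (⊤ : Submodule (MonoidAlgebra ℤ C) M) := trivial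
    rw [← hn] at hx
    obtain ⟨_, ⟨u, rfl⟩, _, ⟨v, rfl⟩, huv⟩ := Submodule.mem_sup.1 hx
    exact ⟨u, v, huv.symm⟩
  obtain ⟨e, he, hex⟩ := exists_nat_smul_aeval_smul_eq_zero t _ hμ
  obtain ⟨n, hn⟩ := exists_forall_pow_smul_eq_add s hprime e he
  exact exists_pow_smul_eq_of_torsion _ m f hf e hex n hn

/-! ### The nilpotent quotient of the semidirect product -/

theorem moduleSemidirect_mk_mul (u v : M) (c d : C) :
    (⟨Multiplicative.ofAdd u, c⟩ * ⟨Multiplicative.ofAdd v, d⟩ : ModuleSemidirect C M) =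
      ⟨Multiplicative.ofAdd (u + MonoidAlgebra.of ℤ C c • v), c * d⟩ := rfl

/-- The subgroup of `M ⋊ C` formed by the elements of a submodule of `M`. -/
def submoduleSubgroup (P : Submodule (MonoidAlgebra ℤ C) M) : Subgroup (ModuleSemidirect C M) where
  carrier := {g | g.left.toAdd ∈ P ∧ g.right = 1}
  one_mem' := ⟨P.zero_mem, rfl⟩
  mul_mem' := by
    rintro ⟨u, c⟩ ⟨v, d⟩ ⟨hu, hc : c = 1⟩ ⟨hv, hd : d = 1⟩
    subst hc hd
    exact ⟨P.add_mem hu (P.smul_mem _ hv), mul_one _⟩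
  inv_mem' := by
    rintro ⟨u, c⟩ ⟨hu, hc : c = 1⟩
    subst hc
    exact ⟨P.smul_mem _ (P.neg_mem hu), inv_one⟩

theorem mk_mem_submoduleSubgroup {P : Submodule (MonoidAlgebra ℤ C) M} {u : M} (hu : u ∈ P) :
    (⟨Multiplicative.ofAdd u, 1⟩ : ModuleSemidirect C M) ∈ submoduleSubgroup P := ⟨hu, rfl⟩

theorem commutator_mk_one_mk (u v : M) (c : C) :
    ⁅(⟨Multiplicative.ofAdd u, 1⟩ : ModuleSemidirect C M),
      (⟨Multiplicative.ofAdd v, c⟩ : ModuleSemidirect C M)⁆ =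
      ⟨Multiplicative.ofAdd ((MonoidAlgebra.of ℤ C c - 1) • -u), 1⟩ := by
  rw [commutatorElement_def, mul_inv_eq_iff_eq_mul, mul_inv_eq_iff_eq_mul,
    moduleSemidirect_mk_mul, moduleSemidirect_mk_mul, moduleSemidirect_mk_mul, map_one, one_smul,
    one_mul, mul_one]
  congr 2
  rw [sub_smul, smul_neg, one_smul]
  abel

theorem commutator_submoduleSubgroup_le (P : Submodule (MonoidAlgebra ℤ C) M) :
    ⁅submoduleSubgroup P, (⊤ : Subgroup (ModuleSemidirect C M))⁆ ≤
      submoduleSubgroup (augmentationIdeal C • P) := by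
  rw [Subgroup.commutator_le]
  rintro ⟨u, c⟩ ⟨hu, hc : c = 1⟩ ⟨v, d⟩ -
  subst hc
  have := commutator_mk_one_mk u.toAdd v.toAdd d
  rw [ofAdd_toAdd, ofAdd_toAdd] at this
  rw [this]
  exact mk_mem_submoduleSubgroup
    (Submodule.smul_mem_smul (of_sub_one_mem_augmentationIdeal d) (P.neg_mem hu))

theorem submoduleSubgroup_le_commutator {t : C} (ht : ∀ c : C, c ∈ Subgroup.zpowers t)
    (P : Submodule (MonoidAlgebra ℤ C) M) :
    submoduleSubgroup (augmentationIdeal C • P) ≤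
      ⁅submoduleSubgroup P, (⊤ : Subgroup (ModuleSemidirect C M))⁆ := by
  rintro ⟨u, c⟩ ⟨hu, hc : c = 1⟩
  subst hc
  rw [augmentationIdeal_eq_span ht, Submodule.ideal_span_singleton_smul,
    Submodule.mem_smul_pointwise_iff_exists] at hu
  obtain ⟨p, hp, hpu⟩ := hu
  have := commutator_mk_one_mk (-p) 0 t
  rw [neg_neg, hpu] at this
  change (⟨Multiplicative.ofAdd u.toAdd, 1⟩ : ModuleSemidirect C M) ∈ _
  rw [← this]
  exact Subgroup.commutator_mem_commutator (mk_mem_submoduleSubgroup (P.neg_mem hp)) trivial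

instance (P : Submodule (MonoidAlgebra ℤ C) M) : (submoduleSubgroup P).Normal := by
  refine ⟨fun n hn g => ?_⟩
  have h : ⁅n, g⁆ ∈ submoduleSubgroup P :=
    ⟨Submodule.smul_le_right (commutator_submoduleSubgroup_le P
      (Subgroup.commutator_mem_commutator hn trivial)).1,
      (commutator_submoduleSubgroup_le P (Subgroup.commutator_mem_commutator hn trivial)).2⟩
  have : g * n * g⁻¹ = ⁅n, g⁆⁻¹ * n := by rw [commutatorElement_def]; group
  rw [this]
  exact mul_mem (inv_mem h) hn

/-- The shift by one comes from the first step, which only uses that `C` is abelian. -/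
theorem lowerCentralSeries_moduleSemidirect_le (n : ℕ) :
    (⊤ : Subgroup (ModuleSemidirect C M)).lowerCentralSeries (n + 1) ≤
      submoduleSubgroup (augmentationIdeal C ^ n • ⊤) := by
  induction n with
  | zero =>
    rw [Subgroup.lowerCentralSeries_succ, Subgroup.lowerCentralSeries_zero, Subgroup.commutator_le]
    intro g _ h _
    refine ⟨by rw [pow_zero, Ideal.one_eq_top, Submodule.top_smul]; trivial, ?_⟩
    simp [commutatorElement_def, mul_comm g.right]
  | succ n ih =>
    rw [Subgroup.lowerCentralSeries_succ, pow_succ', ← Ideal.smul_eq_mul, Submodule.smul_assoc]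
    exact (Subgroup.commutator_mono ih le_rfl).trans (commutator_submoduleSubgroup_le _)

theorem isNilpotent_quotient_submoduleSubgroup (n : ℕ) :
    Group.IsNilpotent (ModuleSemidirect C M ⧸
      submoduleSubgroup (augmentationIdeal C ^ n • (⊤ : Submodule (MonoidAlgebra ℤ C) M))) := by
  rw [Subgroup.nilpotent_iff_lowerCentralSeries]
  refine ⟨n + 1, ?_⟩
  rw [← Subgroup.map_top_of_surjective _ (QuotientGroup.mk'_surjective _),
    ← Subgroup.map_lowerCentralSeries, Subgroup.map_eq_bot_iff, QuotientGroup.ker_mk']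
  exact lowerCentralSeries_moduleSemidirect_le n
end

theorem mainTheorem7 {C : Type v} [CommGroup C] [IsCyclic C] [Infinite C]
    {M : Type u} [AddCommGroup M] [Module (MonoidAlgebra ℤ C) M] (hM : IsTame C M)
    (t : C) (ht : ∀ c : C, c ∈ Subgroup.zpowers t)
    (m : ℕ) (f : ℤ[X])
    (hμ : minpoly ℚ (rationalAction M t) =
      ((Polynomial.X - 1) ^ m * f).map (Int.castRingHom ℚ))
    (hf : f.eval 1 = 1 ∨ f.eval 1 = -1) :
    IsPrenilpotent C M ∧
      ∃ τ < Ordinal.omega0.{max u v}, HasHZLength (ModuleSemidirect C M) τ := by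
  obtain ⟨n, hn⟩ := hM.exists_pow_smul_eq ht m f hμ hf
  have hpre := isPrenilpotent_of_pow_smul ht n hn
  refine ⟨hpre, ?_⟩
  obtain ⟨N, hN⟩ := hpre
  have hstab := hN N le_rfl
  have hcomm : submoduleSubgroup (augmentationIdeal C ^ N • (⊤ : Submodule (MonoidAlgebra ℤ C) M)) ≤
      ⁅submoduleSubgroup (augmentationIdeal C ^ N • (⊤ : Submodule (MonoidAlgebra ℤ C) M)), ⊤⁆ := by
    refine le_trans (le_of_eq ?_) (submoduleSubgroup_le_commutator ht _)
    rw [← Submodule.smul_assoc, Ideal.smul_eq_mul, ← pow_succ', ← hstab]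
  have := isNilpotent_quotient_submoduleSubgroup (C := C) (M := M) N
  refine ⟨_, ?_, (isHZLocalization_mk' _ hcomm).hasHZLength⟩
  rw [← Nat.cast_add_one]
  exact Ordinal.natCast_lt_omega0 _
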